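/- For $n\ge 1$ let $\mathcal M_{2n-1}(\mathbb R)=\{(m_1(\mu),\dots,m_{2n-1}(\mu))\}\subset\mathbb R^{2n-1}$, where $\mu$ runs through the Borel probability measures on $\mathbb R$ having moments $m_j(\mu)=\int x^j\,d\mu$ of all orders. For $\vec m=\vec m_{2n-1}$ in the interior of $\mathcal M_{2n-1}(\mathbb R)$ let $P_0=1,P_1,\dots,P_n$ be the associated monic orthogonal polynomials $$P_k(x)=\det\begin{pmatrix} m_0&\cdots&m_{k-1}&1\\ \vdots&&\vdots&\vdots\\ m_k&\cdots&m_{2k-1}&x^k\end{pmatrix}\Big/\det\,(m_{i+j})_{0\le i,j\le k-1},\qquad m_0=1,$$ and let $b_k=b_k(\vec m)$ $(1\le k\le n)$ and $a_k=a_k(\vec m)$ $(1\le k\le n-1)$ be the coefficients of their three-term recurrence $xP_k=P_{k+1}+b_{k+1}P_k+a_kP_{k-1}$ (with $P_1=x-b_1$), which are determined by $\int x^kP_k\,d\mu=a_1\cdots a_k$ and $\int x^{k+1}P_k\,d\mu=a_1\cdots a_k(b_1+\dots+b_{k+1})$ for any $\mu$ with first moments $\vec m$. For parameters $\gamma_k>-1$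 and $\delta_k>0$ let $h_{2n-1}^{(\gamma,\delta)}$ be the density (with respect to Lebesgue measure, equal to $0$ outside the interior of $\mathcal M_{2n-1}(\mathbb R)$) $$h_{2n-1}^{(\gamma,\delta)}(\vec m)=\prod_{k=1}^n\sqrt{\tfrac{\delta_{2k-1}}{\pi}}\,e^{-\delta_{2k-1}b_k^2}\ \prod_{k=1}^{n-1}\frac{\delta_{2k}^{\gamma_k+2n-2k}}{\Gamma(\gamma_k+2n-2k)}\,a_k^{\gamma_k}e^{-\delta_{2k}a_k}\mathbf 1_{\{a_k>0\}} .$$ **Theorem.** Fix a sequence $(\gamma_k)_{k\ge1}$ with $\gamma_k>-1$. For every $n\ge1$ let the random vector $\vec m_{2n-1}$ have a law with density $h_{2n-1}^{(\gamma,\delta)}$, where $\delta_{2k-1}=n$ for $1\le k\le n$ and $\delta_{2k}=2n$ for $1\le k\le n-1$. For $k\in\mathbb N$ let $\vec m_k^{(n)}$ be the projection of $\vec m_{2n-1}$ onto the first $k$ coordinates ($2n-1\ge k$), and let $\vec m_k(\rho)$ be the vector of the first $k$ moments of the semicircle law $d\rho(x)=\frac1{2\pi}\sqrt{4-x^2}\,\mathbf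 1_{\{-2<x<2\}}\,dx$; it equals the vector of the first $k$ terms of $(0,c_1,0,c_2,\dots)$ with $c_m=\frac1{m+1}\binom{2m}{m}$. Let $D=(d_{i,j})$ be the lower triangular $k\times k$ matrix with $$d_{i,j}=\binom{i}{\frac{i-j}2}-\binom{i}{\frac{i-j}2-1}\quad\text{if } j\le i \text{ and } i+j \text{ is even},$$ and $d_{i,j}=0$ otherwise (where $\binom{i}{-1}=0$). Then $D$ is invertible and $$\sqrt{2n}\,D^{-1}\big(\vec m_k^{(n)}-\vec m_k(\rho)\big)\xrightarrow[n\to\infty]{\mathcal D}\mathcal N_k(0,I_k).$$ -/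

import Mathlib

open MeasureTheory ProbabilityTheory Filter Polynomial
open scoped Topology Matrix

noncomputable section

namespace RandomMoments

/-- The `N`-th moment space `𝓜_N(ℝ)`: all vectors `(m_1(μ), …, m_N(μ))`, where `μ` runs through the
Borel probability measures on `ℝ` with existing moments. The moment of order `i + 1` is stored
in the coordinate `i : Fin N`. -/
def momentSpace (N : ℕ) : Set (Fin N → ℝ) :=
  {m | ∃ μ : Measure ℝ, IsProbabilityMeasure μ ∧ (∀ j : ℕ, Integrable (fun x : ℝ => x ^ j) μ) ∧
    ∀ i : Fin N, m i = ∫ x, x ^ ((i : ℕ) + 1) ∂μ}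

/-- The moment `m_j` read off from a moment vector: `m_0 = 1`, and `m_j` for `1 ≤ j ≤ N` is the
corresponding entry (orders above `N` are never used below; they get the value `0`). -/
def momentOf {N : ℕ} (m : Fin N → ℝ) : ℕ → ℝ
  | 0 => 1
  | j + 1 => if h : j < N then m ⟨j, h⟩ else 0

/-- `∫ p dμ` for a polynomial `p` and a measure `μ` with moment vector `m`. -/
def integralPoly {N : ℕ} (m : Fin N → ℝ) (p : ℝ[X]) : ℝ :=
  p.sum fun j c => c * momentOf m j

/-- The monic orthogonal polynomial `P_k` associated with a moment vector: the determinant of the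
`(k+1) × (k+1)` matrix with rows `(m_i, …, m_{i+k-1}, x^i)`, `i = 0, …, k`, divided by the Hankel
determinant `det (m_{i+j})_{0 ≤ i, j ≤ k-1}`. -/
def orthoPoly {N : ℕ} (m : Fin N → ℝ) (k : ℕ) : ℝ[X] :=
  C (Matrix.of fun i j : Fin k => momentOf m ((i : ℕ) + j)).det⁻¹ *
    (Matrix.of fun i j : Fin (k + 1) =>
      if (j : ℕ) < k then C (momentOf m ((i : ℕ) + j)) else X ^ (i : ℕ)).det

/-- `∫ x^k P_k dμ`, which equals `a_1 ⋯ a_k`. -/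
def wallA {N : ℕ} (m : Fin N → ℝ) (k : ℕ) : ℝ :=
  integralPoly m (X ^ k * orthoPoly m k)

/-- `∫ x^{k+1} P_k dμ`, which equals `a_1 ⋯ a_k (b_1 + ⋯ + b_{k+1})`. -/
def wallB {N : ℕ} (m : Fin N → ℝ) (k : ℕ) : ℝ :=
  integralPoly m (X ^ (k + 1) * orthoPoly m k)

/-- The coefficient `a_k`, `k ≥ 1`, of the three-term recurrence
`x P_k = P_{k+1} + b_{k+1} P_k + a_k P_{k-1}`, determined by `∫ x^k P_k dμ = a_1 ⋯ a_k`. -/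
def recA {N : ℕ} (m : Fin N → ℝ) (k : ℕ) : ℝ :=
  wallA m k / wallA m (k - 1)

/-- The coefficient `b_k`, `k ≥ 1`, of the three-term recurrence, determined by
`∫ x^{k+1} P_k dμ = a_1 ⋯ a_k (b_1 + ⋯ + b_{k+1})` for `k ≥ 0`. -/
def recB {N : ℕ} (m : Fin N → ℝ) (k : ℕ) : ℝ :=
  wallB m (k - 1) / wallA m (k - 1) - if k = 1 then 0 else wallB m (k - 2) / wallA m (k - 2)

open Classical in
/-- The density `h_{2n-1}^{(γ,δ)}` on the moment space `𝓜_{2n-1}(ℝ)` (with respect to Lebesgue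
measure; the recursion coefficients live on the interior, and the boundary is a null set). -/
def density (γ δ : ℕ → ℝ) (n : ℕ) (m : Fin (2 * n - 1) → ℝ) : ℝ :=
  if m ∈ interior (momentSpace (2 * n - 1)) then
    (∏ k ∈ Finset.Icc 1 n,
      √(δ (2 * k - 1) / Real.pi) * Real.exp (-δ (2 * k - 1) * recB m k ^ 2)) *
    ∏ k ∈ Finset.Icc 1 (n - 1),
      δ (2 * k) ^ (γ k + 2 * n - 2 * k) / Real.Gamma (γ k + 2 * n - 2 * k) *
        recA m k ^ γ k * Real.exp (-δ (2 * k) * recA m k) * (if 0 < recA m k then 1 else 0)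
  else 0

/-- The probability distribution on `ℝ^{2n-1}` with Lebesgue density `h_{2n-1}^{(γ,δ)}`. -/
def momentLaw (γ δ : ℕ → ℝ) (n : ℕ) : Measure (Fin (2 * n - 1) → ℝ) :=
  volume.withDensity fun m => ENNReal.ofReal (density γ δ n m)

/-- Wigner's semicircle law `ρ` on `[-2, 2]`. -/
def semicircle : Measure ℝ :=
  volume.withDensity fun x => ENNReal.ofReal
    ((Set.Ioo (-2 : ℝ) 2).indicator (fun x => 1 / (2 * Real.pi) * √(4 - x ^ 2)) x)

/-- The vector `(m_1(ρ), …, m_k(ρ))` of the first `k` moments of the semicircle law. -/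
def semicircleMoments (k : ℕ) : Fin k → ℝ :=
  fun i => ∫ x, x ^ ((i : ℕ) + 1) ∂semicircle

/-- The projection onto the first `k` coordinates of `ℝ^N`. It is used for `k ≤ N`; if `k > N`,
the missing coordinates are filled with `0`. -/
def proj (k : ℕ) {N : ℕ} (m : Fin N → ℝ) : Fin k → ℝ :=
  fun i => if h : (i : ℕ) < N then m ⟨i, h⟩ else 0

/-- The number `binom(i, (i-j)/2) - binom(i, (i-j)/2 - 1)` if `j ≤ i` and `i + j` is even, and
`0` otherwise. Here `binom(i, -1) = 0`. -/
def entryD (i j : ℕ) : ℝ :=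
  if j ≤ i ∧ Even (i + j) then
    (i.choose ((i - j) / 2) : ℝ) - if i = j then 0 else (i.choose ((i - j) / 2 - 1) : ℝ)
  else 0

/-- The lower triangular matrix `D = (d_{i,j})_{1 ≤ i, j ≤ k}`. -/
def matD (k : ℕ) : Matrix (Fin k) (Fin k) ℝ :=
  Matrix.of fun i j => entryD ((i : ℕ) + 1) ((j : ℕ) + 1)

end RandomMoments

end

/-! The moment of order `j` is the total weight of the closed Motzkin paths of length `j`, weighted
by the recursion coefficients. Splitting paths evaluates the Hankel determinants, so `a_k` and `b_k`
can be read off the moments, and the map from the coefficients `(b_1, a_1, b_2, …)` to the moments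
is injective with a triangular derivative. The determinant of this derivative is a product of powers
of the `a_k`, which turns `h_{2n-1}^{(γ,δ)}` into a product density: the coefficients are
independent, `b_k` is Gaussian and `a_k` has a Gamma law. For the given `δ` they fluctuate around
`(0, 1, 0, 1, …)`, the coefficients of the semicircle law, with standard Gaussian limits at scale
`√(2n)`. The derivative of the moment map at this point counts paths of steps `±1` with a marked
step; these counts are the ballot numbers that form the matrix `D`. -/

noncomputable section

namespace RandomMoments

open Finset.HasAntidiagonal (antidiagonal mem_antidiagonal)

/-! ### Weighted Motzkin paths -/

section MotzkinPaths

variable {R : Type*}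

/-- The total weight of the Motzkin paths of length `j` from height `0` to height `h`, where a
level step at height `l` has weight `x (2 * l)`, a down step from height `l + 1` to height `l` has
weight `x (2 * l + 1)`, and up steps have weight `1`. -/
def pathWeight [CommSemiring R] (x : ℕ → R) : ℕ → ℕ → R
  | 0, 0 => 1
  | 0, _ + 1 => 0
  | j + 1, 0 => x 0 * pathWeight x j 0 + x 1 * pathWeight x j 1
  | j + 1, h + 1 => pathWeight x j h + x (2 * (h + 1)) * pathWeight x j (h + 1) +
      x (2 * (h + 1) + 1) * pathWeight x j (h + 2)

/-- The total weight of the down steps that lead from height `h` to height `0`. -/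
def downProd [CommSemiring R] (x : ℕ → R) (h : ℕ) : R := ∏ l ∈ Finset.range h, x (2 * l + 1)

/-- The total weight of the closed Motzkin paths of length `i + 1` with one marked step, level at
height `l / 2` for even `l` and down to height `l / 2` for odd `l`. The marked step has weight `1`,
the steps before it are weighted by `x` and the steps after it by `z`. -/
def markedPathWeight [CommSemiring R] (x z : ℕ → R) (i l : ℕ) : R :=
  ∑ p ∈ antidiagonal i,
    pathWeight x p.1 ((l + 1) / 2) * downProd z (l / 2) * pathWeight z p.2 (l / 2)

section CommSemiring

variable [CommSemiring R] (x z : ℕ → R)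

theorem pathWeight_of_lt {j h : ℕ} (hjh : j < h) : pathWeight x j h = 0 := by
  induction j generalizing h with
  | zero =>
    obtain ⟨h, rfl⟩ := Nat.exists_eq_add_one.2 hjh
    rfl
  | succ j ih =>
    obtain ⟨h, rfl⟩ := Nat.exists_eq_add_one.2 (Nat.zero_lt_of_lt hjh)
    simp [pathWeight, ih (show j < h by lia), ih (show j < h + 1 by lia),
      ih (show j < h + 2 by lia)]

theorem pathWeight_self (j : ℕ) : pathWeight x j j = 1 := by
  induction j with
  | zero => rfl
  | succ j ih => simp [pathWeight, ih, pathWeight_of_lt x (show j < j + 1 by lia),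
      pathWeight_of_lt x (show j < j + 2 by lia)]

theorem pathWeight_succ_self (j : ℕ) :
    pathWeight x (j + 1) j = ∑ l ∈ Finset.range (j + 1), x (2 * l) := by
  induction j with
  | zero => simp [pathWeight]
  | succ j ih =>
    rw [Finset.sum_range_succ, ← ih, pathWeight, pathWeight_self,
      pathWeight_of_lt x (show j + 1 < j + 2 by lia), mul_one, mul_zero, add_zero]

theorem downProd_succ (h : ℕ) : downProd x (h + 1) = downProd x h * x (2 * h + 1) :=
  Finset.prod_range_succ _ _

variable {x z} in
theorem pathWeight_congr {j h : ℕ} (hxz : ∀ l < j + h, x l = z l) :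
    pathWeight x j h = pathWeight z j h := by
  induction j generalizing h with
  | zero => cases h <;> rfl
  | succ j ih =>
    have hstep {l h' : ℕ} (hl : l < j + 1 + h ∨ j < h') (hh : j + h' ≤ j + 1 + h) :
        x l * pathWeight x j h' = z l * pathWeight z j h' := by
      obtain hl | hl := hl
      · rw [hxz l hl, ih fun i hi => hxz i (by lia)]
      · rw [pathWeight_of_lt x hl, pathWeight_of_lt z hl, mul_zero, mul_zero]
    cases h with
    | zero => rw [pathWeight, pathWeight, hstep (by lia) (by lia), hstep (by lia) (by lia)]
    | succ h => rw [pathWeight, pathWeight, ih fun i hi => hxz i (by lia),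
        hstep (by lia) (by lia), hstep (by lia) (by lia)]

variable {x z} in
theorem downProd_congr {h : ℕ} (hxz : ∀ l < 2 * h, x l = z l) : downProd x h = downProd z h :=
  Finset.prod_congr rfl fun l hl => hxz _ (by have := Finset.mem_range.1 hl; lia)

theorem markedPathWeight_of_lt {i l : ℕ} (hil : i < l) : markedPathWeight x z i l = 0 := by
  refine Finset.sum_eq_zero fun ⟨s, t⟩ hst => ?_
  rw [mem_antidiagonal] at hst
  obtain hs | ht : s < (l + 1) / 2 ∨ t < l / 2 := by lia
  · rw [pathWeight_of_lt x hs, zero_mul, zero_mul]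
  · rw [pathWeight_of_lt z ht, mul_zero]

theorem markedPathWeight_self (i : ℕ) : markedPathWeight x z i i = downProd z (i / 2) := by
  rw [markedPathWeight, Finset.sum_eq_single ((i + 1) / 2, i / 2)]
  · simp only [pathWeight_self, one_mul, mul_one]
  · rintro ⟨s, t⟩ hst hne
    rw [mem_antidiagonal] at hst
    rw [ne_eq, Prod.mk.injEq] at hne
    obtain hs | ht : s < (i + 1) / 2 ∨ t < i / 2 := by lia
    · rw [pathWeight_of_lt x hs, zero_mul, zero_mul]
    · rw [pathWeight_of_lt z ht, mul_zero]
  · intro h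
    exact absurd (mem_antidiagonal.2 (by lia)) h

variable {x z} in
theorem markedPathWeight_congr {i l : ℕ} (hxz : ∀ m < i + 1, x m = z m) :
    markedPathWeight x x i l = markedPathWeight z z i l := by
  obtain hil | hil := lt_or_ge i l
  · rw [markedPathWeight_of_lt x x hil, markedPathWeight_of_lt z z hil]
  refine Finset.sum_congr rfl fun ⟨s, t⟩ hst => ?_
  rw [mem_antidiagonal] at hst
  obtain hs | ht | ⟨hs, ht⟩ : s < (l + 1) / 2 ∨ t < l / 2 ∨ (l + 1) / 2 ≤ s ∧ l / 2 ≤ t := by lia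
  · simp only [pathWeight_of_lt _ hs, zero_mul]
  · simp only [pathWeight_of_lt _ ht, mul_zero]
  · rw [pathWeight_congr fun m hm => hxz m (by lia), downProd_congr fun m hm => hxz m (by lia),
      pathWeight_congr fun m hm => hxz m (by lia)]

end CommSemiring

section CommRing

variable [CommRing R] (x z : ℕ → R)

theorem sum_pathWeight_succ_mul_sub (i j n : ℕ) :
    ∑ h ∈ Finset.range (n + 1), pathWeight x (i + 1) h * downProd z h * pathWeight z j h -
        ∑ h ∈ Finset.range (n + 1), pathWeight x i h * downProd z h * pathWeight z (j + 1) h =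
      ∑ h ∈ Finset.range (n + 1),
          ((x (2 * h) - z (2 * h)) * pathWeight x i h +
            (x (2 * h + 1) - z (2 * h + 1)) * pathWeight x i (h + 1)) *
          downProd z h * pathWeight z j h +
        downProd z (n + 1) * (pathWeight x i (n + 1) * pathWeight z j n -
          pathWeight x i n * pathWeight z j (n + 1)) := by
  induction n with
  | zero => simp [pathWeight, downProd]; ring
  | succ n ih =>
    simp only [Finset.sum_range_succ _ (n + 1), downProd_succ z (n + 1), pathWeight]
    linear_combination ih

/-- Splitting a closed path of length `i + j` at time `i`. -/
theorem pathWeight_add_eq_sum {i n : ℕ} (hi : i < n) (j : ℕ) :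
    pathWeight x (i + j) 0 =
      ∑ h ∈ Finset.range n, pathWeight x i h * downProd x h * pathWeight x j h := by
  obtain ⟨n, rfl⟩ := Nat.exists_eq_add_one.2 (Nat.zero_lt_of_lt hi)
  induction i generalizing j with
  | zero => simp [Finset.sum_range_succ', pathWeight, downProd]
  | succ i ih =>
    have hshift := sum_pathWeight_succ_mul_sub x x i j n
    rw [← ih (j + 1) (by lia), pathWeight_of_lt x (show i < n by lia),
      pathWeight_of_lt x (show i < n + 1 by lia)] at hshift
    simp only [sub_self, zero_mul, add_zero, mul_zero, Finset.sum_const_zero] at hshift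
    rw [sub_eq_zero.1 hshift, add_right_comm, add_assoc]

theorem sum_antidiagonal_sub_eq (f : ℕ → ℕ → R) (m : ℕ) :
    ∑ p ∈ antidiagonal m, (f (p.1 + 1) p.2 - f p.1 (p.2 + 1)) =
      f (m + 1) 0 - f 0 (m + 1) := by
  have hfst := Finset.Nat.sum_antidiagonal_succ (n := m) (f := fun p => f p.1 p.2)
  have hsnd := Finset.Nat.sum_antidiagonal_succ' (n := m) (f := fun p => f p.1 p.2)
  rw [Finset.sum_sub_distrib]
  linear_combination hsnd - hfst

@[to_additive sum_range_two_mul]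
theorem prod_range_two_mul {M : Type*} [CommMonoid M] (f : ℕ → M) (n : ℕ) :
    ∏ l ∈ Finset.range (2 * n), f l = ∏ h ∈ Finset.range n, (f (2 * h) * f (2 * h + 1)) := by
  induction n with
  | zero => simp
  | succ n ih => rw [mul_add_one, Finset.prod_range_succ, Finset.prod_range_succ, ih,
      Finset.prod_range_succ, mul_assoc]

/-- The weights `x` are replaced by the weights `z` one step of the path at a time. -/
theorem pathWeight_sub_pathWeight {i M : ℕ} (hi : i < M) :
    pathWeight x (i + 1) 0 - pathWeight z (i + 1) 0 =
      ∑ l ∈ Finset.range M, markedPathWeight x z i l * (x l - z l) := by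
  set mixed : ℕ → ℕ → R := fun s t =>
    ∑ h ∈ Finset.range (M + 1), pathWeight x s h * downProd z h * pathWeight z t h with hmixed
  have hx : mixed (i + 1) 0 = pathWeight x (i + 1) 0 := by
    simp [hmixed, Finset.sum_range_succ', pathWeight, downProd]
  have hz : mixed 0 (i + 1) = pathWeight z (i + 1) 0 := by
    simp [hmixed, Finset.sum_range_succ', pathWeight, downProd]
  have hstep : ∀ p ∈ antidiagonal i, mixed (p.1 + 1) p.2 - mixed p.1 (p.2 + 1) =
      ∑ l ∈ Finset.range (2 * (M + 1)), pathWeight x p.1 ((l + 1) / 2) * downProd z (l / 2) *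
        pathWeight z p.2 (l / 2) * (x l - z l) := by
    intro p hp
    rw [mem_antidiagonal] at hp
    rw [hmixed, sum_pathWeight_succ_mul_sub, pathWeight_of_lt x (show p.1 < M by lia),
      pathWeight_of_lt x (show p.1 < M + 1 by lia), sum_range_two_mul]
    simp only [zero_mul, sub_self, mul_zero, add_zero]
    refine Finset.sum_congr rfl fun h _ => ?_
    rw [show (2 * h + 1) / 2 = h by lia, show 2 * h / 2 = h by lia,
      show (2 * h + 1 + 1) / 2 = h + 1 by lia]
    ring
  rw [← hx, ← hz, ← sum_antidiagonal_sub_eq, Finset.sum_congr rfl hstep, Finset.sum_comm,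
    ← Finset.sum_subset (Finset.range_mono (show M ≤ 2 * (M + 1) by lia))]
  · simp only [markedPathWeight, Finset.sum_mul]
  · intro l _ hl
    rw [← Finset.sum_mul, ← markedPathWeight, markedPathWeight_of_lt x z
      (hi.trans_le (not_lt.1 (Finset.mem_range.not.1 hl))), zero_mul]

end CommRing

end MotzkinPaths

/-! ### Hankel determinants and orthogonal polynomials -/

/-- The Hankel matrix `(s (i + j))` with `0 ≤ i, j < k` of a sequence `s`. -/
def hankelMatrix {R : Type*} (s : ℕ → R) (k : ℕ) : Matrix (Fin k) (Fin k) R :=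
  Matrix.of fun i j => s ((i : ℕ) + j)

/-- Splitting the paths at the row index factors the matrix as `L * diagonal * U` with a
unitriangular matrix `L`. -/
theorem det_updateCol_hankelMatrix_pathWeight {R : Type*} [CommRing R] (x : ℕ → R) (k e : ℕ) :
    ((hankelMatrix (pathWeight x · 0) (k + 1)).updateCol (Fin.last k)
      fun i => pathWeight x ((i : ℕ) + e) 0).det =
      (∏ h ∈ Finset.range (k + 1), downProd x h) * pathWeight x e k := by
  set L : Matrix (Fin (k + 1)) (Fin (k + 1)) R := Matrix.of fun i h => pathWeight x i h with hL
  set w : Fin (k + 1) → R := fun h => pathWeight x e h with hw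
  set P : Matrix (Fin (k + 1)) (Fin (k + 1)) R := Matrix.diagonal fun h => downProd x h with hP
  have hsplit (i : Fin (k + 1)) (j : ℕ) : pathWeight x ((i : ℕ) + j) 0 =
      ((L * P) *ᵥ fun h : Fin (k + 1) => pathWeight x j h) i := by
    simp only [hL, hP, Matrix.mulVec, dotProduct, Matrix.mul_diagonal, Matrix.of_apply]
    rw [pathWeight_add_eq_sum x i.2, Finset.sum_range]
  have hfactor : (hankelMatrix (pathWeight x · 0) (k + 1)).updateCol (Fin.last k)
      (fun i => pathWeight x ((i : ℕ) + e) 0) = L * P * Lᵀ.updateCol (Fin.last k) w := by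
    rw [Matrix.mul_updateCol]
    congr 1
    · ext i j
      exact hsplit i j
    · ext i
      exact hsplit i e
  have hdetL : L.det = 1 := by
    rw [Matrix.det_of_isLowerTriangular L fun i j hij => pathWeight_of_lt x hij]
    simp [hL, pathWeight_self]
  have hdetU : (Lᵀ.updateCol (Fin.last k) w).det = pathWeight x e k := by
    rw [Matrix.det_of_isUpperTriangular, Fin.prod_univ_castSucc]
    · simp [hL, hw, pathWeight_self, (Fin.castSucc_lt_last _).ne]
    · intro i j (hij : j < i)
      rw [Matrix.updateCol_ne (hij.trans_le (Fin.le_last i)).ne]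
      exact pathWeight_of_lt x hij
  rw [hfactor, Matrix.det_mul, Matrix.det_mul, hdetL, hdetU, hP, Matrix.det_diagonal, one_mul,
    Finset.prod_range]

theorem det_hankelMatrix_pathWeight {R : Type*} [CommRing R] (x : ℕ → R) (k : ℕ) :
    (hankelMatrix (pathWeight x · 0) k).det = ∏ h ∈ Finset.range k, downProd x h := by
  cases k with
  | zero => simp
  | succ k =>
    have hdet := det_updateCol_hankelMatrix_pathWeight x k k
    rw [pathWeight_self, mul_one] at hdet
    rw [← hdet]
    exact congrArg Matrix.det (Matrix.updateCol_eq_self _ (Fin.last k)).symm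

theorem map_det_updateCol {ι R A : Type*} [Fintype ι] [DecidableEq ι] [CommRing R] [CommRing A]
    [Algebra R A] (L : A →ₗ[R] R) (M : Matrix ι ι R) (j : ι) (v : ι → A) :
    L ((M.map (algebraMap R A)).updateCol j v).det = (M.updateCol j (L ∘ v)).det := by
  have hadj : (M.map (algebraMap R A)).adjugate = M.adjugate.map (algebraMap R A) :=
    ((algebraMap R A).map_adjugate M).symm
  rw [← Matrix.cramer_apply, ← Matrix.cramer_apply, Matrix.cramer_eq_adjugate_mulVec,
    Matrix.cramer_eq_adjugate_mulVec, hadj]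
  simp only [Matrix.mulVec, dotProduct, Matrix.map_apply, ← Algebra.smul_def, map_sum, map_smul,
    smul_eq_mul, Function.comp_apply]

theorem orthoPoly_eq {N : ℕ} (m : Fin N → ℝ) (k : ℕ) :
    orthoPoly m k = C (hankelMatrix (momentOf m) k).det⁻¹ *
      (((hankelMatrix (momentOf m) (k + 1)).map (algebraMap ℝ ℝ[X])).updateCol (Fin.last k)
        fun i => X ^ (i : ℕ)).det := by
  rw [orthoPoly]
  congr 2
  ext1 i j
  induction j using Fin.lastCases with
  | last => simp
  | cast j => simp [hankelMatrix, (Fin.castSucc_lt_last j).ne]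

theorem integralPoly_eq_lsum {N : ℕ} (m : Fin N → ℝ) (p : ℝ[X]) :
    integralPoly m p = Polynomial.lsum (fun j => LinearMap.mulRight ℝ (momentOf m j)) p :=
  rfl

theorem integralPoly_X_pow {N : ℕ} (m : Fin N → ℝ) (j : ℕ) :
    integralPoly m (X ^ j) = momentOf m j := by
  rw [integralPoly, X_pow_eq_monomial, sum_monomial_index _ _ (by simp), one_mul]

theorem integralPoly_X_pow_mul_orthoPoly {N : ℕ} (m : Fin N → ℝ) (e k : ℕ) :
    integralPoly m (X ^ e * orthoPoly m k) = (hankelMatrix (momentOf m) k).det⁻¹ *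
      ((hankelMatrix (momentOf m) (k + 1)).updateCol (Fin.last k)
        fun i => momentOf m ((i : ℕ) + e)).det := by
  rw [orthoPoly_eq, mul_left_comm, ← Matrix.det_updateCol_smul, ← smul_eq_C_mul,
    integralPoly_eq_lsum, map_smul, map_det_updateCol, smul_eq_mul]
  congr 3
  ext i
  rw [Function.comp_apply, Pi.smul_apply, smul_eq_mul, ← pow_add, add_comm,
    ← integralPoly_eq_lsum, integralPoly_X_pow]

/-! ### Moments as functions of the recursion coefficients -/

/-- The extension of a vector by zeros to a sequence. -/
def zeroExtend {R : Type*} [Zero R] {N : ℕ} (x : Fin N → R) : ℕ → R :=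
  fun i => if h : i < N then x ⟨i, h⟩ else 0

theorem zeroExtend_of_lt {R : Type*} [Zero R] {N : ℕ} (x : Fin N → R) {i : ℕ} (h : i < N) :
    zeroExtend x i = x ⟨i, h⟩ := dif_pos h

theorem zeroExtend_of_le {R : Type*} [Zero R] {N : ℕ} (x : Fin N → R) {i : ℕ} (h : N ≤ i) :
    zeroExtend x i = 0 := dif_neg (by lia)

theorem zeroExtend_coe {R : Type*} [Zero R] {N : ℕ} (x : Fin N → R) (i : Fin N) :
    zeroExtend x i = x i :=
  zeroExtend_of_lt x i.2

theorem continuous_zeroExtend {R : Type*} [Zero R] [TopologicalSpace R] {N : ℕ} :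
    Continuous (zeroExtend : (Fin N → R) → ℕ → R) := by
  refine continuous_pi fun i => ?_
  obtain h | h := lt_or_ge i N
  · simpa only [zeroExtend_of_lt _ h] using continuous_apply _
  · simpa only [zeroExtend_of_le _ h] using continuous_const

/-- The map from the recursion coefficients `(b_1, a_1, b_2, a_2, …)` to the first `N` moments. The
moment of order `j` is the total weight of the closed Motzkin paths of length `j` in which a level
step at height `l` has weight `b_{l+1}` and a down step to height `l` has weight `a_{l+1}`. -/
def momentMap (N : ℕ) (x : Fin N → ℝ) : Fin N → ℝ :=
  fun i => pathWeight (zeroExtend x) (i + 1) 0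

theorem momentOf_momentMap {N : ℕ} (x : Fin N → ℝ) {j : ℕ} (hj : j ≤ N) :
    momentOf (momentMap N x) j = pathWeight (zeroExtend x) j 0 := by
  cases j with
  | zero => rfl
  | succ j => simp only [momentOf, momentMap, dif_pos (Nat.lt_of_succ_le hj)]

theorem integralPoly_X_pow_mul_orthoPoly_momentMap {N e k : ℕ} {x : Fin N → ℝ}
    (hk : 2 * k ≤ N) (he : k + e ≤ N) (hx : ∀ h < k, downProd (zeroExtend x) h ≠ 0) :
    integralPoly (momentMap N x) (X ^ e * orthoPoly (momentMap N x) k) =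
      downProd (zeroExtend x) k * pathWeight (zeroExtend x) e k := by
  have hhankel : hankelMatrix (momentOf (momentMap N x)) k =
      hankelMatrix (pathWeight (zeroExtend x) · 0) k := by
    ext i j
    exact momentOf_momentMap x (by lia)
  have hlast : (hankelMatrix (momentOf (momentMap N x)) (k + 1)).updateCol (Fin.last k)
        (fun i => momentOf (momentMap N x) ((i : ℕ) + e)) =
      (hankelMatrix (pathWeight (zeroExtend x) · 0) (k + 1)).updateCol (Fin.last k)
        fun i => pathWeight (zeroExtend x) ((i : ℕ) + e) 0 := by
    ext1 i j
    induction j using Fin.lastCases with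
    | last => simpa using momentOf_momentMap x (by lia)
    | cast j =>
      simpa [hankelMatrix, (Fin.castSucc_lt_last j).ne] using momentOf_momentMap x (by lia)
  have hprod : ∏ h ∈ Finset.range k, downProd (zeroExtend x) h ≠ 0 :=
    Finset.prod_ne_zero_iff.2 fun h hh => hx h (Finset.mem_range.1 hh)
  rw [integralPoly_X_pow_mul_orthoPoly, hhankel, hlast, det_hankelMatrix_pathWeight,
    det_updateCol_hankelMatrix_pathWeight, Finset.prod_range_succ, mul_assoc,
    inv_mul_cancel_left₀ hprod]

/-- The vectors of recursion coefficients `(b_1, a_1, b_2, a_2, …)` with positive `a_k`. -/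
def positiveCoeffs (N : ℕ) : Set (Fin N → ℝ) := {x | ∀ i : Fin N, Odd (i : ℕ) → 0 < x i}

theorem isOpen_positiveCoeffs (N : ℕ) : IsOpen (positiveCoeffs N) := by
  simp only [positiveCoeffs, Set.ofPred_forall]
  exact isOpen_iInter_of_finite fun i => isOpen_iInter_of_finite fun _ =>
    isOpen_lt continuous_const (continuous_apply i)

theorem zeroExtend_pos {N : ℕ} {x : Fin N → ℝ} (hx : x ∈ positiveCoeffs N) {l : ℕ}
    (hl : 2 * l + 1 < N) : 0 < zeroExtend x (2 * l + 1) := by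
  rw [zeroExtend_of_lt x hl]
  exact hx _ ⟨l, rfl⟩

theorem downProd_pos {N : ℕ} {x : Fin N → ℝ} (hx : x ∈ positiveCoeffs N) {h : ℕ}
    (hh : 2 * h ≤ N) : 0 < downProd (zeroExtend x) h :=
  Finset.prod_pos fun l hl => zeroExtend_pos hx (by have := Finset.mem_range.1 hl; lia)

theorem wallA_momentMap {N k : ℕ} {x : Fin N → ℝ} (hx : x ∈ positiveCoeffs N) (hk : 2 * k ≤ N) :
    wallA (momentMap N x) k = downProd (zeroExtend x) k := by
  rw [wallA, integralPoly_X_pow_mul_orthoPoly_momentMap hk (by lia)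
    fun h hh => (downProd_pos hx (by lia)).ne', pathWeight_self, mul_one]

theorem wallB_momentMap {N k : ℕ} {x : Fin N → ℝ} (hx : x ∈ positiveCoeffs N)
    (hk : 2 * k + 1 ≤ N) : wallB (momentMap N x) k =
      downProd (zeroExtend x) k * ∑ l ∈ Finset.range (k + 1), zeroExtend x (2 * l) := by
  rw [wallB, integralPoly_X_pow_mul_orthoPoly_momentMap (by lia) (by lia)
    fun h hh => (downProd_pos hx (by lia)).ne', pathWeight_succ_self]

theorem recA_momentMap {N k : ℕ} {x : Fin N → ℝ} (hx : x ∈ positiveCoeffs N)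
    (hk : 2 * (k + 1) ≤ N) : recA (momentMap N x) (k + 1) = zeroExtend x (2 * k + 1) := by
  rw [recA, Nat.add_sub_cancel, wallA_momentMap hx hk, wallA_momentMap hx (by lia), downProd_succ,
    mul_div_cancel_left₀ _ (downProd_pos hx (by lia)).ne']

theorem recB_momentMap {N k : ℕ} {x : Fin N → ℝ} (hx : x ∈ positiveCoeffs N)
    (hk : 2 * k + 1 ≤ N) : recB (momentMap N x) (k + 1) = zeroExtend x (2 * k) := by
  have hdiv (l : ℕ) (hl : 2 * l + 1 ≤ N) : wallB (momentMap N x) l / wallA (momentMap N x) l =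
      ∑ i ∈ Finset.range (l + 1), zeroExtend x (2 * i) := by
    rw [wallA_momentMap hx (by lia), wallB_momentMap hx hl,
      mul_div_cancel_left₀ _ (downProd_pos hx (by lia)).ne']
  rw [recB, Nat.add_sub_cancel, hdiv k hk]
  cases k with
  | zero => simp
  | succ k =>
    rw [if_neg (by lia), show k + 1 + 1 - 2 = k by lia, hdiv k (by lia), Finset.sum_range_succ,
      add_sub_cancel_left]

theorem injOn_momentMap (N : ℕ) : Set.InjOn (momentMap N) (positiveCoeffs N) := by
  intro x hx y hy hxy
  ext i
  rw [← zeroExtend_coe x, ← zeroExtend_coe y]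
  obtain ⟨k, hk | hk⟩ := Nat.even_or_odd' (i : ℕ)
  · rw [hk, ← recB_momentMap hx (by lia), ← recB_momentMap hy (by lia), hxy]
  · rw [hk, ← recA_momentMap hx (by lia), ← recA_momentMap hy (by lia), hxy]

/-! ### The derivative of the moment map -/

theorem hasStrictFDerivAt_of_sub_eq {𝕜 E F : Type*} [NontriviallyNormedField 𝕜]
    [NormedAddCommGroup E] [NormedSpace 𝕜 E] [NormedAddCommGroup F] [NormedSpace 𝕜 F] {f : E → F}
    {A : E × E → E →L[𝕜] F} {x : E} (hA : ContinuousAt A (x, x))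
    (hf : ∀ y z, f y - f z = A (y, z) (y - z)) : HasStrictFDerivAt f (A (x, x)) x := by
  have hsmall : (fun p => ‖A p - A (x, x)‖) =o[𝓝 (x, x)] fun _ => (1 : ℝ) :=
    (Asymptotics.isLittleO_one_iff ℝ).2 (tendsto_iff_norm_sub_tendsto_zero.1 hA)
  have hbound : (fun p : E × E => f p.1 - f p.2 - A (x, x) (p.1 - p.2)) =O[𝓝 (x, x)]
      fun p => ‖A p - A (x, x)‖ * ‖p.1 - p.2‖ :=
    .of_norm_le fun p => by
      rw [hf, ← sub_apply]
      exact ContinuousLinearMap.le_opNorm _ _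
  refine .of_isLittleO (hbound.trans_isLittleO ?_)
  simpa using hsmall.mul_isBigO (Asymptotics.isBigO_refl (fun p : E × E => ‖p.1 - p.2‖) _)

section Continuity

variable {R : Type*} [CommSemiring R] [TopologicalSpace R] [IsTopologicalSemiring R]

@[fun_prop]
theorem continuous_pathWeight (j h : ℕ) : Continuous fun x : ℕ → R => pathWeight x j h := by
  induction j generalizing h with
  | zero => cases h <;> exact continuous_const
  | succ j ih => cases h <;> (simp only [pathWeight]; fun_prop)

@[fun_prop]
theorem continuous_downProd (h : ℕ) : Continuous fun x : ℕ → R => downProd x h := by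
  simp only [downProd]
  fun_prop

theorem continuous_markedPathWeight (i l : ℕ) :
    Continuous fun p : (ℕ → R) × (ℕ → R) => markedPathWeight p.1 p.2 i l := by
  simp only [markedPathWeight]
  fun_prop

end Continuity

/-- The matrix `A (y, x)` with `momentMap N y - momentMap N x = A (y, x) *ᵥ (y - x)`. On the
diagonal it is the Jacobian matrix of `momentMap N`. -/
def momentMapSlope {N : ℕ} (p : (Fin N → ℝ) × (Fin N → ℝ)) : Matrix (Fin N) (Fin N) ℝ :=
  Matrix.of fun i l => markedPathWeight (zeroExtend p.1) (zeroExtend p.2) i l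

theorem momentMap_sub_momentMap {N : ℕ} (y x : Fin N → ℝ) :
    momentMap N y - momentMap N x = momentMapSlope (y, x) *ᵥ (y - x) := by
  ext i
  simp only [Pi.sub_apply, momentMap, pathWeight_sub_pathWeight _ _ i.2, Finset.sum_range,
    zeroExtend_coe, momentMapSlope, Matrix.mulVec, dotProduct, Matrix.of_apply]

theorem continuous_momentMapSlope (N : ℕ) :
    Continuous (momentMapSlope : (Fin N → ℝ) × (Fin N → ℝ) → Matrix (Fin N) (Fin N) ℝ) :=
  continuous_matrix fun i l => (continuous_markedPathWeight i l).comp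
    (continuous_zeroExtend.prodMap continuous_zeroExtend)

theorem det_momentMapSlope_self {N : ℕ} (x : Fin N → ℝ) :
    (momentMapSlope (x, x)).det = ∏ i : Fin N, downProd (zeroExtend x) (i / 2) := by
  rw [Matrix.det_of_isLowerTriangular (momentMapSlope (x, x)) fun i l hil =>
       markedPathWeight_of_lt _ _ hil]
  simp only [momentMapSlope, Matrix.of_apply, markedPathWeight_self]

/-- The derivative of `momentMap N`. -/
def momentMapDeriv {N : ℕ} (x : Fin N → ℝ) : (Fin N → ℝ) →L[ℝ] (Fin N → ℝ) :=
  (momentMapSlope (x, x)).toLin'.toContinuousLinearMap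

theorem hasStrictFDerivAt_momentMap {N : ℕ} (x : Fin N → ℝ) :
    HasStrictFDerivAt (momentMap N) (momentMapDeriv x) x := by
  have hcont : Continuous (Matrix.toLin' ≪≫ₗ LinearMap.toContinuousLinearMap :
      Matrix (Fin N) (Fin N) ℝ ≃ₗ[ℝ] (Fin N → ℝ) →L[ℝ] (Fin N → ℝ)) :=
    LinearMap.continuous_of_finiteDimensional (LinearEquiv.toLinearMap _)
  exact hasStrictFDerivAt_of_sub_eq (hcont.comp (continuous_momentMapSlope N)).continuousAt
    momentMap_sub_momentMap

theorem continuous_momentMap (N : ℕ) : Continuous (momentMap N) :=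
  continuous_iff_continuousAt.2 fun x => (hasStrictFDerivAt_momentMap x).continuousAt

theorem det_momentMapDeriv {N : ℕ} (x : Fin N → ℝ) :
    (momentMapDeriv x).det = ∏ i : Fin N, downProd (zeroExtend x) (i / 2) := by
  rw [momentMapDeriv, LinearMap.det_toContinuousLinearMap, LinearMap.det_toLin',
    det_momentMapSlope_self]

theorem det_momentMapDeriv_pos {N : ℕ} {x : Fin N → ℝ} (hx : x ∈ positiveCoeffs N) :
    0 < (momentMapDeriv x).det := by
  rw [det_momentMapDeriv]
  exact Finset.prod_pos fun i _ => downProd_pos hx (by lia)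

/-! ### The semicircle coefficients and ballot numbers -/

/-- The recursion coefficients `(b_1, a_1, b_2, a_2, …) = (0, 1, 0, 1, …)` of the semicircle
law. -/
def freeCoeff (i : ℕ) : ℝ := if Even i then 0 else 1

theorem freeCoeff_two_mul (h : ℕ) : freeCoeff (2 * h) = 0 := by simp [freeCoeff]

theorem freeCoeff_two_mul_add_one (h : ℕ) : freeCoeff (2 * h + 1) = 1 := by simp [freeCoeff]

theorem downProd_freeCoeff (h : ℕ) : downProd freeCoeff h = 1 := by
  simp [downProd, freeCoeff_two_mul_add_one]

/-- The ballot numbers: `ballot i j` is the number of nonnegative paths of length `i` with steps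
`±1` from height `0` to height `j`. -/
def ballot (i j : ℕ) : ℝ := pathWeight freeCoeff i j

theorem ballot_zero_zero : ballot 0 0 = 1 := by simp [ballot, pathWeight]

theorem ballot_zero_succ (h : ℕ) : ballot 0 (h + 1) = 0 := by simp [ballot, pathWeight]

theorem ballot_succ_zero (i : ℕ) : ballot (i + 1) 0 = ballot i 1 := by
  simp [ballot, pathWeight, freeCoeff]

theorem ballot_succ_succ (i h : ℕ) : ballot (i + 1) (h + 1) = ballot i h + ballot i (h + 2) := by
  simp [ballot, pathWeight, freeCoeff_two_mul, freeCoeff_two_mul_add_one]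

theorem ballot_self (i : ℕ) : ballot i i = 1 := pathWeight_self _ i

theorem ballot_of_lt {i j : ℕ} (hij : i < j) : ballot i j = 0 := pathWeight_of_lt _ hij

theorem ballot_of_odd {i j : ℕ} (hij : Odd (i + j)) : ballot i j = 0 := by
  induction i generalizing j with
  | zero => cases j with
    | zero => simp at hij
    | succ j => exact ballot_zero_succ j
  | succ i ih => cases j with
    | zero => rw [ballot_succ_zero, ih hij]
    | succ j => rw [ballot_succ_succ, ih (by grind), ih (by grind), add_zero]

theorem ballot_eq_choose_sub_choose {i j m : ℕ} (h : i = 2 * m + j) :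
    ballot i j = i.choose m - i.choose (m + j + 1) := by
  induction i generalizing j m with
  | zero =>
    obtain ⟨rfl, rfl⟩ : m = 0 ∧ j = 0 := by lia
    simp [ballot_zero_zero]
  | succ i ih => cases m with
    | zero =>
      obtain rfl : i + 1 = j := by lia
      simp [ballot_self]
    | succ m => cases j with
      | zero =>
        rw [ballot_succ_zero, ih (m := m) (by lia)]
        simp only [Nat.choose_succ_succ', Nat.cast_add]
        ring
      | succ j =>
        rw [ballot_succ_succ, ih (m := m + 1) (by lia), ih (m := m) (by lia),
          show m + 1 + (j + 1) + 1 = m + 1 + j + 1 + 1 by ring,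
          show m + (j + 2) + 1 = m + 1 + j + 1 + 1 by ring]
        simp only [Nat.choose_succ_succ', Nat.cast_add]
        ring

theorem ballot_two_mul_zero (m : ℕ) : ballot (2 * m) 0 = (2 * m).choose m / (m + 1) := by
  have hchoose : ((2 * m).choose (m + 1) : ℝ) * (m + 1) = (2 * m).choose m * m := by
    have := Nat.choose_succ_right_eq (2 * m) m
    rw [show 2 * m - m = m by lia] at this
    exact_mod_cast this
  rw [ballot_eq_choose_sub_choose (add_zero _).symm, eq_div_iff (by positivity), sub_mul,
    add_zero, hchoose]
  ring

theorem entryD_eq_ballot (i j : ℕ) : entryD i j = ballot i j := by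
  unfold entryD
  split_ifs with hpath hij
  · rw [hij, ballot_self]
    simp
  · obtain ⟨hji, c, hc⟩ := hpath
    rw [ballot_eq_choose_sub_choose (m := (i - j) / 2) (by lia),
      Nat.choose_symm_of_eq_add (a := (i - j) / 2 - 1) (b := (i - j) / 2 + j + 1) (by lia)]
  · obtain hlt | hge := lt_or_ge i j
    · rw [ballot_of_lt hlt]
    · exact (ballot_of_odd (by grind)).symm

theorem sum_antidiagonal_ballot_mul_ballot (i p q : ℕ) :
    ∑ s ∈ antidiagonal i, ballot s.1 p * ballot s.2 q = ballot (i + 1) (p + q + 1) := by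
  induction i generalizing p with
  | zero => cases p <;> cases q <;>
      simp [ballot_succ_succ, ballot_zero_zero, ballot_of_lt]
  | succ i ih =>
    rw [Finset.Nat.sum_antidiagonal_succ]
    cases p with
    | zero =>
      simp only [ballot_succ_zero, ballot_zero_zero, one_mul, ih, zero_add]
      rw [ballot_succ_succ (i + 1), add_comm 1 q]
    | succ p =>
      simp only [ballot_succ_succ _ p, ballot_zero_succ, zero_mul, zero_add, add_mul,
        Finset.sum_add_distrib, ih]
      rw [ballot_succ_succ (i + 1), show p + 1 + q = p + q + 1 by ring,
        show p + 2 + q + 1 = p + q + 1 + 2 by ring]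

theorem markedPathWeight_freeCoeff (i l : ℕ) :
    markedPathWeight freeCoeff freeCoeff i l = ballot (i + 1) (l + 1) := by
  have hl : (l + 1) / 2 + l / 2 = l := by lia
  simpa only [markedPathWeight, downProd_freeCoeff, mul_one, hl, ballot] using
    sum_antidiagonal_ballot_mul_ballot i ((l + 1) / 2) (l / 2)

/-- The first `N` terms of `freeCoeff`. -/
def freeCoeffs (N : ℕ) : Fin N → ℝ := fun i => freeCoeff i

theorem zeroExtend_freeCoeffs {N i : ℕ} (hi : i < N) :
    zeroExtend (freeCoeffs N) i = freeCoeff i :=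
  zeroExtend_of_lt _ hi

theorem momentMap_freeCoeffs {N : ℕ} (i : Fin N) :
    momentMap N (freeCoeffs N) i = ballot (i + 1) 0 :=
  pathWeight_congr fun _ hl => zeroExtend_freeCoeffs (by lia)

theorem momentMapSlope_freeCoeffs (N : ℕ) :
    momentMapSlope (freeCoeffs N, freeCoeffs N) = matD N := by
  ext i l
  rw [momentMapSlope, matD, Matrix.of_apply, Matrix.of_apply, entryD_eq_ballot,
    ← markedPathWeight_freeCoeff]
  exact markedPathWeight_congr fun _ hl => zeroExtend_freeCoeffs (by lia)

theorem det_matD (N : ℕ) : (matD N).det = 1 := by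
  rw [← momentMapSlope_freeCoeffs, det_momentMapSlope_self]
  refine Finset.prod_eq_one fun i _ => ?_
  rw [← downProd_freeCoeff (i / 2)]
  exact downProd_congr fun _ hl => zeroExtend_freeCoeffs (by lia)

/-! ### Interior points of the moment space -/

theorem pow_apply_self_eq_sum_eigenvalues_pow {𝕜 ι : Type*} [RCLike 𝕜] [Fintype ι] [DecidableEq ι]
    {A : Matrix ι ι 𝕜} (hA : A.IsHermitian) (i : ι) (j : ℕ) :
    (A ^ j) i i = ∑ k, (‖hA.eigenvectorBasis k i‖ ^ 2 * hA.eigenvalues k ^ j : ℝ) := by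
  conv_lhs => rw [hA.spectral_theorem, ← map_pow, Matrix.diagonal_pow]
  rw [Unitary.conjStarAlgAut_apply, Matrix.mul_apply]
  simp only [Matrix.mul_diagonal, Matrix.star_apply, Matrix.IsHermitian.eigenvectorUnitary_apply,
    Pi.pow_apply, Function.comp_apply, RCLike.star_def]
  push_cast
  refine Finset.sum_congr rfl fun k _ => ?_
  rw [mul_right_comm, RCLike.mul_conj]

theorem exists_isProbabilityMeasure_integral_pow_eq {𝕜 ι : Type*} [RCLike 𝕜] [Fintype ι]
    [DecidableEq ι] {A : Matrix ι ι 𝕜} (hA : A.IsHermitian) (i : ι) :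
    ∃ μ : Measure ℝ, IsProbabilityMeasure μ ∧ (∀ j : ℕ, Integrable (fun x => x ^ j) μ) ∧
      ∀ j : ℕ, (∫ x, x ^ j ∂μ : ℝ) = (A ^ j) i i := by
  have hint (j : ℕ) (k : ι) : Integrable (fun x : ℝ => x ^ j)
      (ENNReal.ofReal (‖hA.eigenvectorBasis k i‖ ^ 2) • Measure.dirac (hA.eigenvalues k)) :=
    (integrable_dirac (by simp)).smul_measure ENNReal.ofReal_ne_top
  have hmass : ∑ k, ‖hA.eigenvectorBasis k i‖ ^ 2 = 1 := by
    have := pow_apply_self_eq_sum_eigenvalues_pow hA i 0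
    simp only [pow_zero, Matrix.one_apply_eq, mul_one] at this
    exact_mod_cast this.symm
  refine ⟨∑ k, ENNReal.ofReal (‖hA.eigenvectorBasis k i‖ ^ 2) • Measure.dirac (hA.eigenvalues k),
    ⟨?_⟩, fun j => integrable_finsetSum_measure.2 fun k _ => hint j k, fun j => ?_⟩
  · simp only [Measure.finsetSum_apply, Measure.smul_apply, measure_univ, smul_eq_mul, mul_one]
    rw [← ENNReal.ofReal_sum_of_nonneg fun k _ => sq_nonneg _, hmass, ENNReal.ofReal_one]
  · rw [pow_apply_self_eq_sum_eigenvalues_pow hA, integral_finsetSum_measure fun k _ => hint j k]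
    simp only [integral_smul_measure, integral_dirac, smul_eq_mul,
      ENNReal.toReal_ofReal (sq_nonneg _)]

/-- The Jacobi matrix of size `n` with diagonal entries `b_{h+1} = x (2 * h)` and off-diagonal
entries `√a_{h+1} = √(x (2 * h + 1))`. -/
def jacobiMatrix (n : ℕ) (x : ℕ → ℝ) : Matrix (Fin n) (Fin n) ℝ :=
  Matrix.of fun i l => (if (l : ℕ) = i then x (2 * i) else 0) +
    (if (l : ℕ) = i + 1 then √(x (2 * i + 1)) else 0) +
    (if (l : ℕ) + 1 = i then √(x (2 * l + 1)) else 0)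

theorem isHermitian_jacobiMatrix (n : ℕ) (x : ℕ → ℝ) : (jacobiMatrix n x).IsHermitian := by
  ext i l
  simp only [jacobiMatrix, Matrix.conjTranspose_apply, Matrix.of_apply, star_trivial]
  grind

theorem jacobiMatrix_mulVec {n : ℕ} {x : ℕ → ℝ} (hx : ∀ h, 0 ≤ x (2 * h + 1))
    (hn : x (2 * n + 1) = 0) (j : ℕ) :
    (jacobiMatrix (n + 1) x) *ᵥ (fun h : Fin (n + 1) => pathWeight x j h * √(downProd x h)) =
      fun h : Fin (n + 1) => pathWeight x (j + 1) h * √(downProd x h) := by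
  have hsqrt (h : ℕ) : √(downProd x (h + 1)) = √(downProd x h) * √(x (2 * h + 1)) := by
    have hprod : 0 ≤ downProd x h := Finset.prod_nonneg fun l _ => hx l
    rw [downProd_succ, Real.sqrt_mul hprod]
  have hup (h : ℕ) (hh : h < n + 1) :
      (if h + 1 < n + 1 then
          √(x (2 * h + 1)) * (pathWeight x j (h + 1) * √(downProd x (h + 1))) else 0) =
        x (2 * h + 1) * pathWeight x j (h + 1) * √(downProd x h) := by
    split_ifs with hlt
    · rw [hsqrt]
      linear_combination pathWeight x j (h + 1) * √(downProd x h) * Real.mul_self_sqrt (hx h)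
    · rw [show h = n by lia, hn, zero_mul, zero_mul]
  ext ⟨h, hh⟩
  simp only [Matrix.mulVec, dotProduct, jacobiMatrix, Matrix.of_apply]
  rw [← Finset.sum_range fun l => ((if l = h then x (2 * h) else 0) +
    (if l = h + 1 then √(x (2 * h + 1)) else 0) +
    (if l + 1 = h then √(x (2 * l + 1)) else 0)) * (pathWeight x j l * √(downProd x l))]
  simp only [add_mul, Finset.sum_add_distrib, ite_mul, zero_mul, Finset.sum_ite_eq',
    Finset.mem_range, hup h hh, if_pos hh]
  cases h with
  | zero => simp [pathWeight, add_mul, mul_assoc]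
  | succ h =>
    simp only [pathWeight, hsqrt, Nat.add_right_cancel_iff, Finset.sum_ite_eq', Finset.mem_range,
      if_pos (Nat.lt_of_succ_lt hh)]
    ring

theorem jacobiMatrix_pow_zero_zero {n : ℕ} {x : ℕ → ℝ} (hx : ∀ h, 0 ≤ x (2 * h + 1))
    (hn : x (2 * n + 1) = 0) (j : ℕ) :
    (jacobiMatrix (n + 1) x ^ j) 0 0 = pathWeight x j 0 := by
  have hpow : jacobiMatrix (n + 1) x ^ j *ᵥ Pi.single 0 1 =
      fun h : Fin (n + 1) => pathWeight x j h * √(downProd x h) := by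
    induction j with
    | zero =>
      ext h
      cases h using Fin.cases <;> simp [pathWeight, downProd]
    | succ j ih => rw [pow_succ', ← Matrix.mulVec_mulVec, ih, jacobiMatrix_mulVec hx hn]
  simpa [downProd] using congrFun hpow 0

theorem momentMap_mem_momentSpace {n : ℕ} {x : Fin (2 * n + 1) → ℝ}
    (hx : x ∈ positiveCoeffs (2 * n + 1)) :
    momentMap (2 * n + 1) x ∈ momentSpace (2 * n + 1) := by
  have hnonneg (h : ℕ) : 0 ≤ zeroExtend x (2 * h + 1) := by
    obtain hlt | hge := lt_or_ge (2 * h + 1) (2 * n + 1)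
    · exact (zeroExtend_pos hx hlt).le
    · exact (zeroExtend_of_le x hge).ge
  obtain ⟨μ, hμ, hint, hmoments⟩ := exists_isProbabilityMeasure_integral_pow_eq
    (isHermitian_jacobiMatrix (n + 1) (zeroExtend x)) 0
  refine ⟨μ, hμ, hint, fun i => ?_⟩
  rw [momentMap, ← jacobiMatrix_pow_zero_zero hnonneg (zeroExtend_of_le x le_rfl)]
  exact (hmoments _).symm

theorem momentMap_mem_interior {n : ℕ} {x : Fin (2 * n + 1) → ℝ}
    (hx : x ∈ positiveCoeffs (2 * n + 1)) :
    momentMap (2 * n + 1) x ∈ interior (momentSpace (2 * n + 1)) := by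
  have hsurj : (momentMapDeriv x).range = ⊤ := LinearMap.range_eq_top.2
    (LinearMap.equivOfDetNeZero _ (det_momentMapDeriv_pos hx).ne').surjective
  rw [mem_interior_iff_mem_nhds,
    ← (hasStrictFDerivAt_momentMap x).map_nhds_eq_of_surj hsurj, mem_map]
  filter_upwards [(isOpen_positiveCoeffs _).mem_nhds hx] with y hy
  exact momentMap_mem_momentSpace hy

/-! ### The law of the moments as an image of a product measure -/

section Densities

variable {ι E : Type*} [Fintype ι] [MeasurableSpace E]

theorem lintegral_fin_nat_prod_eq_prod {n : ℕ} {μ : Fin n → Measure E} [∀ i, SigmaFinite (μ i)]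
    {f : Fin n → E → ENNReal} (hf : ∀ i, Measurable (f i)) :
    ∫⁻ x, ∏ i, f i (x i) ∂Measure.pi μ = ∏ i, ∫⁻ y, f i y ∂μ i := by
  induction n with
  | zero => simp
  | succ n ih =>
    have hmeas {m : ℕ} {g : Fin m → E → ENNReal} (hg : ∀ i, Measurable (g i)) :
        Measurable fun x : Fin m → E => ∏ i, g i (x i) := by
      fun_prop
    rw [← (measurePreserving_piFinSuccAbove μ 0).symm.lintegral_comp (hmeas hf)]
    simp only [Fin.prod_univ_succ, MeasurableEquiv.piFinSuccAbove_symm_apply,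
      Fin.insertNthEquiv_zero, Fin.consEquiv_apply, Fin.cons_zero, Fin.cons_succ,
      Fin.succAbove_zero, ← ih fun i => hf i.succ]
    exact lintegral_prod_mul (hf 0).aemeasurable (hmeas fun i => hf i.succ).aemeasurable

theorem lintegral_fintype_prod_eq_prod {μ : ι → Measure E} [∀ i, SigmaFinite (μ i)]
    {f : ι → E → ENNReal} (hf : ∀ i, Measurable (f i)) :
    ∫⁻ x, ∏ i, f i (x i) ∂Measure.pi μ = ∏ i, ∫⁻ y, f i y ∂μ i := by
  let e := (Fintype.equivFin ι).symm
  rw [← (measurePreserving_piCongrLeft μ e).lintegral_comp_emb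
    (MeasurableEquiv.measurableEmbedding _)]
  simp_rw [← e.prod_comp, MeasurableEquiv.coe_piCongrLeft, Equiv.piCongrLeft_apply_apply]
  exact lintegral_fin_nat_prod_eq_prod fun i => hf (e i)

theorem pi_withDensity {μ : ι → Measure E} [∀ i, SigmaFinite (μ i)]
    {f : ι → E → ENNReal} [∀ i, SigmaFinite ((μ i).withDensity (f i))]
    (hf : ∀ i, Measurable (f i)) :
    Measure.pi (fun i => (μ i).withDensity (f i)) =
      (Measure.pi μ).withDensity fun x => ∏ i, f i (x i) := by
  refine Measure.pi_eq fun s hs => ?_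
  simp only [withDensity_apply _ (hs _), withDensity_apply _ (MeasurableSet.univ_pi hs),
    ← lintegral_indicator (hs _), ← lintegral_indicator (MeasurableSet.univ_pi hs)]
  rw [← lintegral_fintype_prod_eq_prod fun i => (hf i).indicator (hs i)]
  refine lintegral_congr fun x => ?_
  by_cases hx : x ∈ Set.univ.pi s
  · rw [Set.indicator_of_mem hx]
    exact Finset.prod_congr rfl fun i _ => (Set.indicator_of_mem (hx i trivial) _).symm
  · obtain ⟨i, hi⟩ : ∃ i, x i ∉ s i := by simpa using hx
    rw [Set.indicator_of_notMem hx, Finset.prod_eq_zero (Finset.mem_univ i)]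
    exact Set.indicator_of_notMem hi _

end Densities

/-- The shape parameter of the Gamma law of the coefficient `a_{(i + 1) / 2}`, for odd `i`. -/
def gammaShape (γ : ℕ → ℝ) (n i : ℕ) : ℝ := γ ((i + 1) / 2) + 2 * n - (i + 1)

/-- The density of the `i`-th of the coefficients `b_1, a_1, b_2, a_2, …`, counted from `0`:
Gaussian for even `i` and Gamma for odd `i`. -/
def coeffPDFReal (γ δ : ℕ → ℝ) (n i : ℕ) : ℝ → ℝ :=
  if Even i then gaussianPDFReal 0 (2 * δ (i + 1))⁻¹.toNNReal
  else gammaPDFReal (gammaShape γ n i) (δ (i + 1))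

/-- The law of the `i`-th of the coefficients `b_1, a_1, b_2, a_2, …`, counted from `0`. -/
def coeffLaw (γ δ : ℕ → ℝ) (n i : ℕ) : Measure ℝ :=
  volume.withDensity fun y => ENNReal.ofReal (coeffPDFReal γ δ n i y)

theorem measurable_coeffPDFReal (γ δ : ℕ → ℝ) (n i : ℕ) : Measurable (coeffPDFReal γ δ n i) := by
  unfold coeffPDFReal
  split_ifs
  · exact measurable_gaussianPDFReal _ _
  · exact measurable_gammaPDFReal _ _

theorem one_lt_gammaShape {γ : ℕ → ℝ} (hγ : ∀ k, 1 ≤ k → -1 < γ k) {n i : ℕ}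
    (hi : i < 2 * n - 1) (hodd : Odd i) : 1 < gammaShape γ n i := by
  have hle : ((i + 3 : ℕ) : ℝ) ≤ (2 * n : ℕ) := by
    obtain ⟨l, rfl⟩ := hodd
    exact_mod_cast (by lia : 2 * l + 1 + 3 ≤ 2 * n)
  push_cast at hle
  rw [gammaShape]
  linarith [hγ ((i + 1) / 2) (by grind)]

theorem coeffLaw_of_even (γ : ℕ → ℝ) {δ : ℕ → ℝ} {i : ℕ} (hδ : 0 < δ (i + 1)) (n : ℕ)
    (hi : Even i) : coeffLaw γ δ n i = gaussianReal 0 (2 * δ (i + 1))⁻¹.toNNReal := by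
  have hvar : (2 * δ (i + 1))⁻¹.toNNReal ≠ 0 := (Real.toNNReal_pos.2 (by positivity)).ne'
  rw [gaussianReal_of_var_ne_zero _ hvar, coeffLaw, coeffPDFReal, if_pos hi]
  rfl

theorem coeffLaw_of_odd (γ δ : ℕ → ℝ) (n : ℕ) {i : ℕ} (hi : Odd i) :
    coeffLaw γ δ n i = gammaMeasure (gammaShape γ n i) (δ (i + 1)) := by
  rw [coeffLaw, coeffPDFReal, if_neg (Nat.not_even_iff_odd.2 hi)]
  rfl

section

variable {γ δ : ℕ → ℝ} {n : ℕ}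

theorem isProbabilityMeasure_coeffLaw (hγ : ∀ k, 1 ≤ k → -1 < γ k) {i : ℕ}
    (hδ : 0 < δ (i + 1)) (hi : i < 2 * n - 1) : IsProbabilityMeasure (coeffLaw γ δ n i) := by
  obtain heven | hodd := Nat.even_or_odd i
  · rw [coeffLaw_of_even γ hδ n heven]
    infer_instance
  · rw [coeffLaw_of_odd γ δ n hodd]
    exact isProbabilityMeasure_gammaMeasure (one_pos.trans (one_lt_gammaShape hγ hi hodd)) hδ

theorem coeffPDFReal_nonneg (hγ : ∀ k, 1 ≤ k → -1 < γ k) {i : ℕ} (hδ : 0 < δ (i + 1))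
    (hi : i < 2 * n - 1) (y : ℝ) : 0 ≤ coeffPDFReal γ δ n i y := by
  unfold coeffPDFReal
  split_ifs with heven
  · exact gaussianPDFReal_nonneg _ _ _
  · have hodd := Nat.not_even_iff_odd.1 heven
    exact gammaPDFReal_nonneg (one_pos.trans (one_lt_gammaShape hγ hi hodd)) hδ _

theorem coeffPDFReal_of_nonpos (hγ : ∀ k, 1 ≤ k → -1 < γ k) {i : ℕ} (hi : i < 2 * n - 1)
    (hodd : Odd i) {y : ℝ} (hy : y ≤ 0) : coeffPDFReal γ δ n i y = 0 := by
  rw [coeffPDFReal, if_neg (Nat.not_even_iff_odd.2 hodd), gammaPDFReal]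
  split_ifs with h
  · rw [le_antisymm hy h, Real.zero_rpow (by linarith [one_lt_gammaShape hγ hi hodd]), mul_zero,
      zero_mul]
  · rfl

theorem coeffPDFReal_two_mul (γ : ℕ → ℝ) (n k : ℕ) (hδ : 0 < δ (2 * k + 1)) (y : ℝ) :
    coeffPDFReal γ δ n (2 * k) y =
      √(δ (2 * k + 1) / Real.pi) * Real.exp (-δ (2 * k + 1) * y ^ 2) := by
  rw [coeffPDFReal, if_pos (even_two_mul k), gaussianPDFReal, ← Real.sqrt_inv,
    Real.coe_toNNReal _ (by positivity)]
  congr 2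
  · field_simp
  · field_simp
    ring

theorem coeffPDFReal_two_mul_add_one {l : ℕ} (hl : l + 1 < n) {y : ℝ} (hy : 0 < y) :
    coeffPDFReal γ δ n (2 * l + 1) y = y ^ (2 * (n - 1 - l) - 1) *
      (δ (2 * (l + 1)) ^ (γ (l + 1) + 2 * n - 2 * (l + 1 : ℕ)) /
        Real.Gamma (γ (l + 1) + 2 * n - 2 * (l + 1 : ℕ)) * y ^ γ (l + 1) *
          Real.exp (-δ (2 * (l + 1)) * y)) := by
  have hshape : gammaShape γ n (2 * l + 1) = γ (l + 1) + 2 * n - 2 * (l + 1 : ℕ) := by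
    rw [gammaShape, show (2 * l + 1 + 1) / 2 = l + 1 by lia]
    push_cast
    ring
  have hpow : y ^ (gammaShape γ n (2 * l + 1) - 1) =
      y ^ (2 * (n - 1 - l) - 1) * y ^ γ (l + 1) := by
    obtain ⟨m, rfl⟩ := Nat.exists_eq_add_of_lt hl
    rw [← Real.rpow_natCast, ← Real.rpow_add hy, hshape,
      show 2 * (l + 1 + m + 1 - 1 - l) - 1 = 2 * m + 1 by lia]
    congr 1
    push_cast
    ring
  rw [coeffPDFReal, if_neg (by simp), gammaPDFReal, if_pos hy.le, hpow, hshape]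
  ring_nf

theorem prod_downProd (x : ℕ → ℝ) (p : ℕ) :
    ∏ i ∈ Finset.range (2 * p + 1), downProd x (i / 2) =
      ∏ l ∈ Finset.range p, x (2 * l + 1) ^ (2 * (p - l) - 1) := by
  induction p with
  | zero => simp [downProd]
  | succ p ih =>
    have hshift : ∏ l ∈ Finset.range p, x (2 * l + 1) ^ (2 * (p + 1 - l) - 1) =
        (∏ l ∈ Finset.range p, x (2 * l + 1) ^ (2 * (p - l) - 1)) * downProd x p ^ 2 := by
      rw [downProd, ← Finset.prod_pow, ← Finset.prod_mul_distrib]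
      refine Finset.prod_congr rfl fun l hl => ?_
      rw [← pow_add, show 2 * (p + 1 - l) - 1 = 2 * (p - l) - 1 + 2 by grind]
    rw [mul_add_one, Finset.prod_range_succ, Finset.prod_range_succ, ih, Finset.prod_range_succ,
      hshift, show (2 * p + 1) / 2 = p by lia, show (2 * p + 1 + 1) / 2 = p + 1 by lia,
      downProd_succ, show 2 * (p + 1 - p) - 1 = 1 by lia]
    ring

theorem prod_range_two_mul_add_one {M : Type*} [CommMonoid M] (f : ℕ → M) (p : ℕ) :
    ∏ i ∈ Finset.range (2 * p + 1), f i =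
      (∏ k ∈ Finset.range (p + 1), f (2 * k)) * ∏ k ∈ Finset.range p, f (2 * k + 1) := by
  rw [Finset.prod_range_succ, prod_range_two_mul, Finset.prod_mul_distrib, Finset.prod_range_succ,
    mul_right_comm]

theorem prod_Icc_one_eq_prod_range {M : Type*} [CommMonoid M] (f : ℕ → M) (p : ℕ) :
    ∏ k ∈ Finset.Icc 1 p, f k = ∏ k ∈ Finset.range p, f (k + 1) := by
  rw [Finset.range_eq_Ico, Finset.prod_Ico_add' f 0 p 1]
  rfl

theorem det_momentMapDeriv_mul_density (hδ : ∀ j, 1 ≤ j → 0 < δ j) (hn : 1 ≤ n)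
    {x : Fin (2 * n - 1) → ℝ} (hx : x ∈ positiveCoeffs (2 * n - 1)) :
    (momentMapDeriv x).det * density γ δ n (momentMap (2 * n - 1) x) =
      ∏ i : Fin (2 * n - 1), coeffPDFReal γ δ n i (x i) := by
  obtain ⟨p, rfl⟩ := Nat.exists_eq_add_one.2 hn
  have hN : 2 * (p + 1) - 1 = 2 * p + 1 := rfl
  have hdet : (momentMapDeriv x).det =
      ∏ l ∈ Finset.range p, zeroExtend x (2 * l + 1) ^ (2 * (p - l) - 1) := by
    rw [det_momentMapDeriv, ← prod_downProd, ← hN, Finset.prod_range]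
  have hpdf : ∏ i : Fin (2 * (p + 1) - 1), coeffPDFReal γ δ (p + 1) i (x i) =
      ∏ i ∈ Finset.range (2 * p + 1), coeffPDFReal γ δ (p + 1) i (zeroExtend x i) := by
    simp only [← hN, Finset.prod_range, zeroExtend_coe]
  have hint : momentMap (2 * (p + 1) - 1) x ∈ interior (momentSpace (2 * (p + 1) - 1)) :=
    momentMap_mem_interior (n := p) hx
  rw [density, if_pos hint, hdet, hpdf, Nat.add_sub_cancel,
    prod_Icc_one_eq_prod_range, prod_Icc_one_eq_prod_range, prod_range_two_mul_add_one,
    mul_left_comm, ← Finset.prod_mul_distrib]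
  congr 1
  · refine Finset.prod_congr rfl fun k hk => ?_
    have hk := Finset.mem_range.1 hk
    rw [recB_momentMap hx (by lia), coeffPDFReal_two_mul γ _ _ (hδ _ (by lia)),
      show 2 * (k + 1) - 1 = 2 * k + 1 by lia]
  · refine Finset.prod_congr rfl fun l hl => ?_
    have hl := Finset.mem_range.1 hl
    have hpos : 0 < zeroExtend x (2 * l + 1) := zeroExtend_pos hx (by lia)
    rw [recA_momentMap hx (by lia), coeffPDFReal_two_mul_add_one (by lia) hpos, if_pos hpos,
      mul_one, Nat.add_sub_cancel]

theorem pi_coeffLaw_eq_withDensity (hγ : ∀ k, 1 ≤ k → -1 < γ k) (hδ : ∀ j, 1 ≤ j → 0 < δ j)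
    (hn : 1 ≤ n) :
    Measure.pi (fun i : Fin (2 * n - 1) => coeffLaw γ δ n i) =
      volume.withDensity ((positiveCoeffs (2 * n - 1)).indicator fun x =>
        ENNReal.ofReal |(momentMapDeriv x).det| *
          ENNReal.ofReal (density γ δ n (momentMap (2 * n - 1) x))) := by
  have (i : Fin (2 * n - 1)) :
      IsProbabilityMeasure (volume.withDensity fun y => ENNReal.ofReal (coeffPDFReal γ δ n i y)) :=
    isProbabilityMeasure_coeffLaw hγ (hδ _ (by lia)) i.2
  simp only [coeffLaw]
  rw [pi_withDensity fun i => (measurable_coeffPDFReal γ δ n _).ennreal_ofReal, ← volume_pi]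
  congr 1 with x
  by_cases hx : x ∈ positiveCoeffs (2 * n - 1)
  · rw [Set.indicator_of_mem hx, abs_of_pos (det_momentMapDeriv_pos hx),
      ← ENNReal.ofReal_mul (det_momentMapDeriv_pos hx).le, det_momentMapDeriv_mul_density hδ hn hx,
      ENNReal.ofReal_prod_of_nonneg fun i _ => coeffPDFReal_nonneg hγ (hδ _ (by lia)) i.2 _]
  · obtain ⟨i, hodd, hi⟩ : ∃ i : Fin (2 * n - 1), Odd (i : ℕ) ∧ x i ≤ 0 := by
      simpa [positiveCoeffs] using hx
    rw [Set.indicator_of_notMem hx, Finset.prod_eq_zero (Finset.mem_univ i)]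
    rw [coeffPDFReal_of_nonpos hγ i.2 hodd hi, ENNReal.ofReal_zero]

theorem map_momentMap_pi_coeffLaw (hγ : ∀ k, 1 ≤ k → -1 < γ k) (hδ : ∀ j, 1 ≤ j → 0 < δ j)
    (hn : 1 ≤ n) [IsProbabilityMeasure (momentLaw γ δ n)] :
    (Measure.pi fun i : Fin (2 * n - 1) => coeffLaw γ δ n i).map (momentMap (2 * n - 1)) =
      momentLaw γ δ n := by
  have (i : Fin (2 * n - 1)) : IsProbabilityMeasure (coeffLaw γ δ n i) :=
    isProbabilityMeasure_coeffLaw hγ (hδ _ (by lia)) i.2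
  have hmap : Measurable (momentMap (2 * n - 1)) := (continuous_momentMap _).measurable
  have := Measure.isProbabilityMeasure_map
    (μ := Measure.pi fun i : Fin (2 * n - 1) => coeffLaw γ δ n i) hmap.aemeasurable
  -- Both sides have mass `1`, so `momentMap` need not be shown to reach all of the interior.
  refine Measure.eq_of_le_of_isProbabilityMeasure (Measure.le_iff.2 fun s hs => ?_)
  have hpos : MeasurableSet (positiveCoeffs (2 * n - 1)) := (isOpen_positiveCoeffs _).measurableSet
  have hpre := hmap hs
  rw [Measure.map_apply hmap hs, pi_coeffLaw_eq_withDensity hγ hδ hn, withDensity_apply _ hpre,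
    momentLaw, withDensity_apply _ hs, lintegral_indicator hpos, Measure.restrict_restrict hpos,
    ← lintegral_image_eq_lintegral_abs_det_fderiv_mul volume (hpos.inter hpre)
      (fun x _ => (hasStrictFDerivAt_momentMap x).hasFDerivAt.hasFDerivWithinAt)
      ((injOn_momentMap _).mono Set.inter_subset_left)
      fun m => ENNReal.ofReal (density γ δ n m)]
  exact lintegral_mono_set (Set.image_subset_iff.2 Set.inter_subset_right)

end

/-! ### The central limit theorem for Gamma variables of large shape -/

theorem eqOn_complexMGF_of_mgf_eq {Ω : Type*} [MeasurableSpace Ω] {X : Ω → ℝ} {μ : Measure Ω}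
    {S : Set ℝ} (hopen : IsOpen S) (hconv : Convex ℝ S) (hS : S ⊆ integrableExpSet X μ)
    {f : ℂ → ℂ} (hf : AnalyticOnNhd ℂ f (Complex.re ⁻¹' S))
    (hmgf : ∀ u ∈ S, (mgf X μ u : ℂ) = f u) :
    Set.EqOn (complexMGF X μ) f (Complex.re ⁻¹' S) := by
  intro z hz
  have hM : AnalyticOnNhd ℂ (complexMGF X μ) (Complex.re ⁻¹' S) :=
    fun w hw => analyticAt_complexMGF (interior_maximal hS hopen hw)
  have hconn : IsPreconnected (Complex.re ⁻¹' S) :=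
    (hconv.linear_preimage Complex.reLm).isPreconnected
  have hreal : ∀ᶠ u : ℝ in 𝓝[≠] z.re, complexMGF X μ u = f u := by
    filter_upwards [mem_nhdsWithin_of_mem_nhds (hopen.mem_nhds hz)] with u hu
    rw [complexMGF_ofReal, hmgf u hu]
  have hofReal : Tendsto ((↑) : ℝ → ℂ) (𝓝[≠] z.re) (𝓝[≠] (z.re : ℂ)) :=
    Complex.continuous_ofReal.continuousWithinAt.tendsto_nhdsWithin
      fun u hu => by simpa using hu
  exact hM.eqOn_of_preconnected_of_frequently_eq hf hconn (z₀ := (z.re : ℂ)) hz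
    (hofReal.frequently hreal.frequently) hz

section Gamma

variable {a r : ℝ}

theorem lintegral_exp_mul_gammaMeasure (ha : 0 < a) (hr : 0 < r) {u : ℝ} (hu : u < r) :
    ∫⁻ y, ENNReal.ofReal (Real.exp (u * y)) ∂gammaMeasure a r =
      ENNReal.ofReal (Real.exp (-a * Real.log (1 - u / r))) := by
  have hru : 0 < r - u := sub_pos.2 hu
  have hmeas : Measurable (gammaPDF a r) := (measurable_gammaPDFReal a r).ennreal_ofReal
  have hratio : Real.exp (-a * Real.log (1 - u / r)) = r ^ a / (r - u) ^ a := by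
    rw [← Real.div_rpow hr.le hru.le, Real.rpow_def_of_pos (div_pos hr hru),
      show 1 - u / r = (r / (r - u))⁻¹ by field_simp, Real.log_inv]
    ring_nf
  -- Exponential tilting turns a Gamma density of rate `r` into one of rate `r - u`.
  have htilt (y : ℝ) : gammaPDFReal a r y * Real.exp (u * y) =
      Real.exp (-a * Real.log (1 - u / r)) * gammaPDFReal a (r - u) y := by
    have : 0 < (r - u) ^ a := Real.rpow_pos_of_pos hru a
    rw [hratio]
    unfold gammaPDFReal
    split_ifs
    · rw [show -((r - u) * y) = -(r * y) + u * y by ring, Real.exp_add]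
      field_simp
    · simp
  rw [gammaMeasure, lintegral_withDensity_eq_lintegral_mul _ hmeas (by fun_prop)]
  simp only [Pi.mul_apply, gammaPDF, ← ENNReal.ofReal_mul' (Real.exp_pos _).le, htilt,
    ENNReal.ofReal_mul (Real.exp_pos _).le]
  rw [lintegral_const_mul _ (measurable_gammaPDFReal a (r - u)).ennreal_ofReal]
  exact (congrArg _ (lintegral_gammaPDF_eq_one ha hru)).trans (mul_one _)

theorem Iio_subset_integrableExpSet_gammaMeasure (ha : 0 < a) (hr : 0 < r) :
    Set.Iio r ⊆ integrableExpSet id (gammaMeasure a r) := by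
  intro u hu
  refine (lintegral_ofReal_ne_top_iff_integrable (by fun_prop)
    (Eventually.of_forall fun _ => (Real.exp_pos _).le)).1 ?_
  simp only [id, lintegral_exp_mul_gammaMeasure ha hr hu, ne_eq, ENNReal.ofReal_ne_top,
    not_false_eq_true]

theorem mgf_id_gammaMeasure (ha : 0 < a) (hr : 0 < r) {u : ℝ} (hu : u < r) :
    mgf id (gammaMeasure a r) u = Real.exp (-a * Real.log (1 - u / r)) := by
  simp only [mgf, id]
  rw [integral_eq_lintegral_of_nonneg_ae (Eventually.of_forall fun _ => (Real.exp_pos _).le)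
    (by fun_prop), lintegral_exp_mul_gammaMeasure ha hr hu,
    ENNReal.toReal_ofReal (Real.exp_pos _).le]

theorem charFun_gammaMeasure (ha : 0 < a) (hr : 0 < r) (t : ℝ) :
    charFun (gammaMeasure a r) t = Complex.exp (-a * Complex.log (1 - t * Complex.I / r)) := by
  have hanalytic : AnalyticOnNhd ℂ (fun z => Complex.exp (-a * Complex.log (1 - z / r)))
      (Complex.re ⁻¹' Set.Iio r) := by
    intro z hz
    have hslit : 1 - z / r ∈ Complex.slitPlane := by
      left
      rw [Complex.sub_re, Complex.one_re, Complex.div_ofReal_re, sub_pos, div_lt_one hr]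
      exact hz
    fun_prop (disch := exact hslit)
  have hmgf (u : ℝ) (hu : u ∈ Set.Iio r) : (mgf id (gammaMeasure a r) u : ℂ) =
      Complex.exp (-a * Complex.log (1 - u / r)) := by
    have hnonneg : 0 ≤ 1 - u / r := sub_nonneg.2 ((div_le_one hr).2 (le_of_lt hu))
    rw [mgf_id_gammaMeasure ha hr hu]
    push_cast [Complex.ofReal_log hnonneg]
    rfl
  rw [← complexMGF_id_mul_I]
  exact eqOn_complexMGF_of_mgf_eq isOpen_Iio (convex_Iio r)
    (Iio_subset_integrableExpSet_gammaMeasure ha hr) hanalytic hmgf (by simpa using hr)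

end Gamma

theorem tendsto_mul_log_one_add_sub {α : Type*} {l : Filter α} {s w : α → ℂ} {a : ℂ}
    (hw : Tendsto w l (𝓝 0)) (hsw : Tendsto (fun x => s x * w x ^ 2) l (𝓝 a)) :
    Tendsto (fun x => s x * (Complex.log (1 + w x) - w x)) l (𝓝 (-a / 2)) := by
  have hsw3 : Tendsto (fun x => s x * w x ^ 3) l (𝓝 0) := by
    simpa only [mul_zero, mul_assoc, ← pow_succ] using hsw.mul hw
  have hrem : Tendsto (fun x => s x * (Complex.log (1 + w x) - Complex.logTaylor 3 (w x))) l
      (𝓝 0) :=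
    ((Asymptotics.isBigO_refl s l).mul
      ((Complex.log_sub_logTaylor_isBigO 2).comp_tendsto hw)).trans_tendsto hsw3
  have hsum := hrem.sub (hsw.div_const 2)
  rw [zero_sub, ← neg_div] at hsum
  refine hsum.congr fun x => ?_
  simp only [Complex.logTaylor, Finset.sum_range_succ, Finset.sum_range_zero]
  push_cast
  ring

theorem tendsto_charFun_gammaMeasure (c t : ℝ) :
    Tendsto (fun s : ℝ => charFun (gammaMeasure (c + s) s) (√s * t) *
      Complex.exp (-(√s * t) * Complex.I)) atTop (𝓝 (Complex.exp (-t ^ 2 / 2))) := by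
  set w : ℝ → ℂ := fun s => -(t * Complex.I / √s) with hwdef
  have hw : Tendsto w atTop (𝓝 0) := by
    rw [tendsto_zero_iff_norm_tendsto_zero]
    simpa [hwdef, abs_of_nonneg] using
      (tendsto_const_nhds (x := |t|)).div_atTop Real.tendsto_sqrt_atTop
  have hsqrt (s : ℝ) (hs : 0 < s) : ((√s : ℝ) : ℂ) ≠ 0 ∧ (s : ℂ) = (√s : ℂ) ^ 2 := by
    rw [← Complex.ofReal_pow, Real.sq_sqrt hs.le]
    exact ⟨by exact_mod_cast (Real.sqrt_pos.2 hs).ne', rfl⟩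
  have hsw : Tendsto (fun s : ℝ => (s : ℂ) * w s ^ 2) atTop (𝓝 (-t ^ 2)) := by
    refine tendsto_const_nhds.congr' ?_
    filter_upwards [eventually_gt_atTop 0] with s hs
    obtain ⟨hne, hsq⟩ := hsqrt s hs
    simp only [hwdef, hsq]
    field_simp
    rw [Complex.I_sq]
    ring
  have hlog : Tendsto (fun s => (c : ℂ) * Complex.log (1 + w s)) atTop (𝓝 0) := by
    have := ((tendsto_const_nhds (x := (1 : ℂ))).add hw).clog (by simp)
    simpa using this.const_mul (c : ℂ)
  have hexp := (hlog.neg.sub (tendsto_mul_log_one_add_sub hw hsw)).cexp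
  rw [show -(0 : ℂ) - -(-(t : ℂ) ^ 2) / 2 = -t ^ 2 / 2 by ring] at hexp
  refine hexp.congr' ?_
  filter_upwards [eventually_gt_atTop 0, eventually_gt_atTop (-c)] with s hs hcs
  obtain ⟨hne, hsq⟩ := hsqrt s hs
  have hmean : (s : ℂ) * w s = -(√s * t) * Complex.I := by
    simp only [hwdef, hsq]
    field_simp
  have hbase : 1 - ((√s * t : ℝ) : ℂ) * Complex.I / s = 1 + w s := by
    simp only [hwdef, hsq]
    push_cast
    field_simp
    ring
  rw [charFun_gammaMeasure (by linarith) hs, ← Complex.exp_add, hbase, ← hmean]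
  push_cast
  ring_nf

/-! ### Convergence in distribution -/

theorem map_prod_dirac {Ω E F G : Type*} [MeasurableSpace Ω] [MeasurableSpace E]
    [MeasurableSpace F] [MeasurableSpace G] {μ : Measure Ω} [SFinite μ] {Z : Ω → E} {f : E × F → G}
    (hZ : AEMeasurable Z μ) (hf : Measurable f) (c : F) :
    ((μ.map Z).prod (Measure.dirac c)).map f = μ.map fun ω => f (Z ω, c) := by
  rw [Measure.prod_dirac, Measure.map_map hf (by fun_prop),
    AEMeasurable.map_map_of_aemeasurable (hf.comp (by fun_prop)).aemeasurable hZ]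
  rfl

section TendstoInDistribution

variable {ι : Type*} {l : Filter ι} {Ω : ι → Type*} [∀ i, MeasurableSpace (Ω i)]
  {μ : (i : ι) → Measure (Ω i)} [∀ i, IsProbabilityMeasure (μ i)]
  {Ω' : Type*} [MeasurableSpace Ω'] {μ' : Measure Ω'} [IsProbabilityMeasure μ']

theorem tendstoInDistribution_of_map_eq {E : Type*} [TopologicalSpace E] [MeasurableSpace E]
    [OpensMeasurableSpace E] {X : (i : ι) → Ω i → E} {Z : Ω' → E}
    {Ξ : ι → Type*} [∀ i, MeasurableSpace (Ξ i)] {ν : (i : ι) → Measure (Ξ i)}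
    [∀ i, IsProbabilityMeasure (ν i)] {Y : (i : ι) → Ξ i → E}
    {Ξ' : Type*} [MeasurableSpace Ξ'] {ν' : Measure Ξ'} [IsProbabilityMeasure ν'] {W : Ξ' → E}
    (h : TendstoInDistribution X l Z μ μ') (hY : ∀ i, AEMeasurable (Y i) (ν i))
    (hW : AEMeasurable W ν') (hXY : ∀ᶠ i in l, (μ i).map (X i) = (ν i).map (Y i))
    (hZW : μ'.map Z = ν'.map W) : TendstoInDistribution Y l W ν ν' where
  forall_aemeasurable := hY
  aemeasurable_limit := hW
  tendsto := by
    refine (h.tendsto.congr' ?_).trans_eq (congrArg 𝓝 (Subtype.ext hZW))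
    filter_upwards [hXY] with i hi
    exact Subtype.ext hi

theorem tendstoInDistribution_pi {κ : Type*} [Fintype κ] {E : κ → Type*}
    [∀ j, TopologicalSpace (E j)] [∀ j, SecondCountableTopology (E j)]
    [∀ j, TopologicalSpace.PseudoMetrizableSpace (E j)] [∀ j, MeasurableSpace (E j)]
    [∀ j, OpensMeasurableSpace (E j)] {X : (i : ι) → Ω i → (j : κ) → E j}
    {ν : (j : κ) → Measure (E j)} [∀ j, IsProbabilityMeasure (ν j)]
    (hindep : ∀ᶠ i in l, iIndepFun (fun j ω => X i ω j) (μ i))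
    (hX : ∀ j, TendstoInDistribution (fun i ω => X i ω j) l id μ (ν j)) :
    TendstoInDistribution X l id μ (Measure.pi ν) where
  forall_aemeasurable i := aemeasurable_pi_lambda _ fun j => (hX j).forall_aemeasurable i
  aemeasurable_limit := aemeasurable_id
  tendsto := by
    have hprod := (ProbabilityMeasure.continuous_pi.tendsto _).comp
      (tendsto_pi_nhds.2 fun j => (hX j).tendsto)
    refine (hprod.congr' ?_).trans_eq (congrArg 𝓝 (Subtype.ext ?_))
    · filter_upwards [hindep] with i hi
      exact Subtype.ext (hi.map_fun_eq_pi_map fun j => (hX j).forall_aemeasurable i).symm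
    · simp only [Measure.map_id]
      rfl

theorem tendstoInDistribution_comp_prodMk
    {E F G : Type*} [TopologicalSpace E] [SecondCountableTopology E]
    [TopologicalSpace.PseudoMetrizableSpace E] [MeasurableSpace E] [OpensMeasurableSpace E]
    [TopologicalSpace F] [SecondCountableTopology F]
    [TopologicalSpace.PseudoMetrizableSpace F] [MeasurableSpace F] [OpensMeasurableSpace F]
    [TopologicalSpace G] [MeasurableSpace G] [BorelSpace G]
    {X : (i : ι) → Ω i → E} {Z : Ω' → E} {e : ι → F} {c : F} {f : E × F → G}
    (hX : TendstoInDistribution X l Z μ μ') (he : Tendsto e l (𝓝 c)) (hf : Continuous f) :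
    TendstoInDistribution (fun i ω => f (X i ω, e i)) l (fun ω => f (Z ω, c)) μ μ' where
  forall_aemeasurable i :=
    (hf.measurable.comp measurable_prodMk_right).comp_aemeasurable (hX.forall_aemeasurable i)
  aemeasurable_limit :=
    (hf.measurable.comp measurable_prodMk_right).comp_aemeasurable hX.aemeasurable_limit
  tendsto := by
    have hlim := ProbabilityMeasure.tendsto_map_of_tendsto_of_continuous _ _
      ((ProbabilityMeasure.continuous_prod.tendsto _).comp
        (hX.tendsto.prodMk_nhds ((continuous_diracProba.tendsto c).comp he))) hf
    refine (hlim.congr fun i => Subtype.ext ?_).trans_eq (congrArg 𝓝 (Subtype.ext ?_))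
    · exact map_prod_dirac (hX.forall_aemeasurable i) hf.measurable (e i)
    · exact map_prod_dirac hX.aemeasurable_limit hf.measurable c

end TendstoInDistribution

/-! ### Moments of the semicircle law -/

theorem integral_pow_semicircle (j : ℕ) :
    ∫ x, x ^ j ∂semicircle =
      1 / (2 * Real.pi) * ∫ x in (-2 : ℝ)..2, x ^ j * √(4 - x ^ 2) := by
  have hmeas : Measurable ((Set.Ioo (-2 : ℝ) 2).indicator
      fun x => 1 / (2 * Real.pi) * √(4 - x ^ 2)) :=
    Measurable.indicator (by fun_prop) measurableSet_Ioo
  rw [semicircle, integral_withDensity_eq_integral_toReal_smul hmeas.ennreal_ofReal (by simp),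
    intervalIntegral.integral_of_le (by norm_num), integral_Ioc_eq_integral_Ioo,
    ← integral_const_mul, ← integral_indicator measurableSet_Ioo]
  refine integral_congr_ae (Eventually.of_forall fun x => ?_)
  simp only [smul_eq_mul]
  rw [ENNReal.toReal_ofReal (Set.indicator_nonneg (fun y _ => by positivity) x)]
  by_cases hx : x ∈ Set.Ioo (-2 : ℝ) 2
  · rw [Set.indicator_of_mem hx, Set.indicator_of_mem hx]
    ring
  · rw [Set.indicator_of_notMem hx, Set.indicator_of_notMem hx, zero_mul]

theorem integral_sqrt_four_sub_sq : ∫ x in (-2 : ℝ)..2, √(4 - x ^ 2) = 2 * Real.pi := by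
  have hscale (x : ℝ) : √(4 - (2 * x) ^ 2) = 2 * √(1 - x ^ 2) := by
    rw [show 4 - (2 * x) ^ 2 = 2 ^ 2 * (1 - x ^ 2) by ring, Real.sqrt_mul (by norm_num),
      Real.sqrt_sq (by norm_num)]
  have hsubst := intervalIntegral.integral_comp_mul_left (a := -1) (b := 1)
    (fun x : ℝ => √(4 - x ^ 2)) (c := 2) two_ne_zero
  simp only [hscale, intervalIntegral.integral_const_mul, integral_sqrt_one_sub_sq,
    smul_eq_mul] at hsubst
  norm_num at hsubst
  linarith

theorem integral_pow_mul_sqrt_four_sub_sq_of_odd {j : ℕ} (hj : Odd j) :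
    ∫ x in (-2 : ℝ)..2, x ^ j * √(4 - x ^ 2) = 0 := by
  have hneg := intervalIntegral.integral_comp_neg (a := -2) (b := 2)
    (fun x : ℝ => x ^ j * √(4 - x ^ 2))
  simp only [hj.neg_pow, even_two.neg_pow, neg_mul, intervalIntegral.integral_neg,
    neg_neg] at hneg
  linarith

theorem hasDerivAt_pow_mul_four_sub_sq_mul_sqrt (j : ℕ) {x : ℝ} (hx : x ∈ Set.Ioo (-2) 2) :
    HasDerivAt (fun x : ℝ => x ^ (j + 1) * ((4 - x ^ 2) * √(4 - x ^ 2)))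
      (4 * (j + 1) * (x ^ j * √(4 - x ^ 2)) - (j + 4) * (x ^ (j + 2) * √(4 - x ^ 2))) x := by
  have hpos : 0 < 4 - x ^ 2 := by nlinarith [hx.1, hx.2]
  have hne : √(4 - x ^ 2) ≠ 0 := (Real.sqrt_pos.2 hpos).ne'
  have hinner : HasDerivAt (fun x : ℝ => 4 - x ^ 2) (-(2 * x)) x := by
    simpa using (hasDerivAt_pow 2 x).const_sub 4
  refine ((hasDerivAt_pow (j + 1) x).mul
    (hinner.mul (hinner.sqrt hpos.ne'))).congr_deriv ?_
  simp only [Nat.add_sub_cancel, Pi.mul_apply]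
  push_cast
  field_simp
  rw [Real.sq_sqrt hpos.le]
  ring

theorem integral_pow_add_two_mul_sqrt_four_sub_sq (j : ℕ) :
    (j + 4) * ∫ x in (-2 : ℝ)..2, x ^ (j + 2) * √(4 - x ^ 2) =
      4 * (j + 1) * ∫ x in (-2 : ℝ)..2, x ^ j * √(4 - x ^ 2) := by
  have hint (i : ℕ) : IntervalIntegrable (fun x : ℝ => x ^ i * √(4 - x ^ 2)) volume (-2) 2 :=
    Continuous.intervalIntegrable (by fun_prop) _ _
  have hftc := intervalIntegral.integral_eq_sub_of_hasDerivAt_of_le (by norm_num : (-2 : ℝ) ≤ 2)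
    (by fun_prop) (fun _ => hasDerivAt_pow_mul_four_sub_sq_mul_sqrt j)
    (((hint j).const_mul _).sub ((hint (j + 2)).const_mul _))
  rw [intervalIntegral.integral_sub ((hint j).const_mul _) ((hint (j + 2)).const_mul _),
    intervalIntegral.integral_const_mul, intervalIntegral.integral_const_mul] at hftc
  norm_num at hftc
  linarith

theorem integral_pow_two_mul_semicircle (m : ℕ) :
    ∫ x, x ^ (2 * m) ∂semicircle = (2 * m).choose m / (m + 1) := by
  rw [integral_pow_semicircle]
  induction m with
  | zero =>
    simp only [mul_zero, pow_zero, one_mul, integral_sqrt_four_sub_sq]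
    simp
    field_simp
  | succ m ih =>
    have hrec := integral_pow_add_two_mul_sqrt_four_sub_sq (2 * m)
    have hchoose : ((m : ℝ) + 1) * ((2 * (m + 1)).choose (m + 1) : ℝ) =
        2 * (2 * m + 1) * ((2 * m).choose m : ℝ) := by
      exact_mod_cast Nat.succ_mul_centralBinom_succ m
    rw [show 2 * (m + 1) = 2 * m + 2 by ring] at hchoose ⊢
    push_cast at hrec hchoose ⊢
    field_simp at ih ⊢
    refine mul_left_cancel₀ (show 2 * ((m : ℝ) + 1) ≠ 0 by positivity) ?_
    linear_combination (m + 1 : ℝ) * hrec + 4 * (2 * m + 1 : ℝ) * ih - 4 * Real.pi * hchoose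

theorem integral_pow_semicircle_eq_ballot (j : ℕ) : ∫ x, x ^ j ∂semicircle = ballot j 0 := by
  obtain ⟨m, rfl | rfl⟩ := Nat.even_or_odd' j
  · rw [integral_pow_two_mul_semicircle, ballot_two_mul_zero]
  · rw [integral_pow_semicircle, integral_pow_mul_sqrt_four_sub_sq_of_odd ⟨m, rfl⟩, mul_zero,
      ballot_of_odd (j := 0) ⟨m, rfl⟩]

theorem semicircleMoments_eq_momentMap (k : ℕ) :
    semicircleMoments k = momentMap k (freeCoeffs k) := by
  ext i
  rw [semicircleMoments, integral_pow_semicircle_eq_ballot, momentMap_freeCoeffs]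

theorem semicircleMoments_apply {k : ℕ} (i : Fin k) :
    semicircleMoments k i = if Even ((i : ℕ) + 1) then
      1 / ((((i : ℕ) + 1) / 2 : ℕ) + 1 : ℝ) *
        ((2 * (((i : ℕ) + 1) / 2)).choose (((i : ℕ) + 1) / 2) : ℝ)
      else 0 := by
  rw [semicircleMoments]
  split_ifs with h
  · obtain ⟨m, hm⟩ := even_iff_exists_two_mul.1 h
    rw [hm, integral_pow_two_mul_semicircle, Nat.mul_div_cancel_left m two_pos, one_div_mul_eq_div]
  · rw [integral_pow_semicircle_eq_ballot,
      ballot_of_odd (j := 0) (Nat.not_even_iff_odd.1 h)]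

/-! ### Convergence of the recursion coefficients -/

/-- The parameters `δ_j` of the theorem: `n` for odd `j` and `2 * n` for even `j`. -/
abbrev scaledRate (n j : ℕ) : ℝ := if Odd j then (n : ℝ) else 2 * n

theorem scaledRate_pos {n : ℕ} (hn : 1 ≤ n) (j : ℕ) : 0 < scaledRate n j := by
  unfold scaledRate
  split_ifs <;> positivity

theorem tendsto_natCast_mul_two : Tendsto (fun n : ℕ => 2 * (n : ℝ)) atTop atTop :=
  tendsto_natCast_atTop_atTop.const_mul_atTop two_pos

theorem charFun_map_mul_sub (μ : Measure ℝ) (c b t : ℝ) :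
    charFun (μ.map fun y => c * (y - b)) t =
      charFun μ (c * t) * Complex.exp (-(c * t * b) * Complex.I) := by
  have hcomp : (fun y => c * (y - b)) = (· + -(c * b)) ∘ fun y => c * y := by
    ext y
    simp only [Function.comp_apply]
    ring
  rw [hcomp, ← Measure.map_map (by fun_prop) (by fun_prop), charFun_map_add_const, charFun_map_mul]
  congr 2
  simp
  ring

theorem map_coeffLaw_of_even (γ : ℕ → ℝ) {n i : ℕ} (hn : 1 ≤ n) (hi : Even i) :
    (coeffLaw γ (scaledRate n) n i).map (fun y => √(2 * n) * (y - freeCoeff i)) =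
      gaussianReal 0 1 := by
  have hodd : Odd (i + 1) := hi.add_one
  simp only [coeffLaw_of_even γ (scaledRate_pos hn _) n hi, freeCoeff, if_pos hi, sub_zero]
  rw [gaussianReal_map_const_mul, mul_zero]
  congr 1
  ext
  rw [NNReal.coe_mul, NNReal.coe_mk, Real.sq_sqrt (by positivity), scaledRate, if_pos hodd,
    Real.coe_toNNReal _ (by positivity), NNReal.coe_one]
  field_simp

theorem tendsto_charFun_map_coeffLaw (γ : ℕ → ℝ) (i : ℕ) (t : ℝ) :
    Tendsto (fun n : ℕ => charFun ((coeffLaw γ (scaledRate n) n i).map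
      fun y => √(2 * n) * (y - freeCoeff i)) t) atTop (𝓝 (charFun (gaussianReal 0 1) t)) := by
  obtain heven | hodd := Nat.even_or_odd i
  · refine tendsto_const_nhds.congr' ?_
    filter_upwards [eventually_ge_atTop 1] with n hn
    rw [map_coeffLaw_of_even γ hn heven]
  · have hgauss : charFun (gaussianReal 0 1) t = Complex.exp (-t ^ 2 / 2) := by
      simp [charFun_gaussianReal, neg_div]
    have hrate (n : ℕ) : scaledRate n (i + 1) = 2 * n :=
      if_neg (Nat.not_odd_iff_even.2 hodd.add_one)
    have hshape (n : ℕ) : gammaShape γ n i = γ ((i + 1) / 2) - (i + 1) + 2 * n := by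
      rw [gammaShape]
      ring
    rw [hgauss]
    refine ((tendsto_charFun_gammaMeasure (γ ((i + 1) / 2) - (i + 1)) t).comp
      tendsto_natCast_mul_two).congr fun n => ?_
    rw [charFun_map_mul_sub, coeffLaw_of_odd γ _ n hodd, hrate, hshape, freeCoeff,
      if_neg (Nat.not_even_iff_odd.2 hodd), Complex.ofReal_one, mul_one]
    rfl

section Fluctuations

variable {γ : ℕ → ℝ} {Ω : ℕ → Type*} [∀ n, MeasurableSpace (Ω n)]
  {P : (n : ℕ) → Measure (Ω n)} [∀ n, IsProbabilityMeasure (P n)]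

section Coefficients

variable {X : (n : ℕ) → Ω n → Fin (2 * n - 1) → ℝ}

theorem tendstoInDistribution_coeff
    (hX : ∀ n i, HasLaw (fun ω => X n ω i) (coeffLaw γ (scaledRate n) n i) (P n)) (i : ℕ) :
    TendstoInDistribution (fun (n : ℕ) ω => √(2 * n) * (zeroExtend (X n ω) i - freeCoeff i))
      atTop id P (gaussianReal 0 1) where
  forall_aemeasurable n := by
    have hcoord : AEMeasurable (fun ω => zeroExtend (X n ω) i) (P n) := by
      unfold zeroExtend
      split_ifs with hi
      · exact (hX n ⟨i, hi⟩).aemeasurable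
      · exact aemeasurable_const
    fun_prop
  aemeasurable_limit := aemeasurable_id
  tendsto := by
    refine ProbabilityMeasure.tendsto_iff_tendsto_charFun.2 fun t => ?_
    simp only [ProbabilityMeasure.coe_mk, Measure.map_id]
    refine (tendsto_charFun_map_coeffLaw γ i t).congr' ?_
    filter_upwards [eventually_gt_atTop i] with n hn
    have hi : i < 2 * n - 1 := by lia
    simp only [zeroExtend_of_lt _ hi]
    rw [← (hX n ⟨i, hi⟩).map_eq,
      AEMeasurable.map_map_of_aemeasurable (by fun_prop) (hX n ⟨i, hi⟩).aemeasurable]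
    rfl

theorem tendstoInDistribution_proj_coeff
    (hX : ∀ n i, HasLaw (fun ω => X n ω i) (coeffLaw γ (scaledRate n) n i) (P n))
    (hindep : ∀ n, iIndepFun (fun i ω => X n ω i) (P n)) (k : ℕ) :
    TendstoInDistribution (fun (n : ℕ) ω => √(2 * n) • (proj k (X n ω) - freeCoeffs k)) atTop id P
      (Measure.pi fun _ => gaussianReal 0 1) := by
  refine tendstoInDistribution_pi ?_ fun i => tendstoInDistribution_coeff hX i
  filter_upwards [eventually_gt_atTop k] with n hn
  have hk : k ≤ 2 * n - 1 := by lia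
  have hlt (i : Fin k) : (i : ℕ) < 2 * n - 1 := i.2.trans_le hk
  have hcomp := ((hindep n).precomp (Fin.castLE_injective hk)).comp
    (fun i y => √(2 * n) * (y - freeCoeff i)) fun i => by fun_prop
  simp only [Pi.smul_apply, Pi.sub_apply, smul_eq_mul, proj, dif_pos (hlt _)]
  exact hcomp

theorem tendstoInDistribution_momentMap_proj_coeff
    (hX : ∀ n i, HasLaw (fun ω => X n ω i) (coeffLaw γ (scaledRate n) n i) (P n))
    (hindep : ∀ n, iIndepFun (fun i ω => X n ω i) (P n)) (k : ℕ) :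
    TendstoInDistribution
      (fun (n : ℕ) ω => √(2 * n) • (momentMap k (proj k (X n ω)) - momentMap k (freeCoeffs k)))
      atTop (fun z => matD k *ᵥ z) P (Measure.pi fun _ => gaussianReal 0 1) := by
  have hstep : Tendsto (fun n : ℕ => (√(2 * n))⁻¹) atTop (𝓝 0) :=
    tendsto_inv_atTop_zero.comp (Real.tendsto_sqrt_atTop.comp tendsto_natCast_mul_two)
  have hslope : Continuous fun p : (Fin k → ℝ) × ℝ =>
      momentMapSlope (freeCoeffs k + p.2 • p.1, freeCoeffs k) *ᵥ p.1 :=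
    Continuous.matrix_mulVec ((continuous_momentMapSlope k).comp (by fun_prop)) continuous_fst
  have hlim := tendstoInDistribution_comp_prodMk
    (tendstoInDistribution_proj_coeff hX hindep k) hstep hslope
  simp only [zero_smul, add_zero, momentMapSlope_freeCoeffs, id] at hlim
  have hexpand (n : ℕ) (x : Fin k → ℝ) :
      √(2 * n) • (momentMap k x - momentMap k (freeCoeffs k)) =
        momentMapSlope (freeCoeffs k + (√(2 * n))⁻¹ • √(2 * n) • (x - freeCoeffs k),
          freeCoeffs k) *ᵥ (√(2 * n) • (x - freeCoeffs k)) := by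
    obtain hzero | hne := eq_or_ne √(2 * (n : ℝ)) 0
    · simp only [hzero, zero_smul, Matrix.mulVec_zero]
    · rw [inv_smul_smul₀ hne, add_sub_cancel, momentMap_sub_momentMap, Matrix.mulVec_smul]
  simpa only [hexpand] using hlim

end Coefficients

theorem proj_momentMap {k N : ℕ} (hk : k ≤ N) (x : Fin N → ℝ) :
    proj k (momentMap N x) = momentMap k (proj k x) := by
  ext i
  have hi : (i : ℕ) < N := i.2.trans_le hk
  rw [proj, dif_pos hi]
  refine pathWeight_congr fun l hl => ?_
  rw [zeroExtend_of_lt (proj k x) (show l < k by lia)]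
  rfl

theorem measurable_proj (k N : ℕ) : Measurable (proj k : (Fin N → ℝ) → Fin k → ℝ) :=
  measurable_pi_lambda _ fun i => ((continuous_apply (i : ℕ)).comp continuous_zeroExtend).measurable

theorem tendstoInDistribution_proj_sub_semicircleMoments {M : (n : ℕ) → Ω n → Fin (2 * n - 1) → ℝ}
    (hγ : ∀ k, 1 ≤ k → -1 < γ k)
    (hM : ∀ n, 1 ≤ n → HasLaw (M n) (momentLaw γ (scaledRate n) n) (P n)) (k : ℕ) :
    TendstoInDistribution (fun (n : ℕ) ω => √(2 * n) • (proj k (M n ω) - semicircleMoments k)) atTop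
      (fun z => matD k *ᵥ z) P (Measure.pi fun _ => gaussianReal 0 1) := by
  set ν : (n : ℕ) → Measure (Fin (2 * n - 1) → ℝ) :=
    fun n => Measure.pi fun i => coeffLaw γ (scaledRate n) n i
  have hcoeffLaw (n : ℕ) (i : Fin (2 * n - 1)) :
      IsProbabilityMeasure (coeffLaw γ (scaledRate n) n i) :=
    isProbabilityMeasure_coeffLaw hγ (scaledRate_pos (by have := i.pos; lia) _) i.2
  have hnorm (n : ℕ) : Measurable fun m : Fin (2 * n - 1) → ℝ =>
      √(2 * n) • (proj k m - semicircleMoments k) :=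
    ((measurable_proj k _).sub_const (semicircleMoments k)).const_smul √(2 * (n : ℝ))
  refine tendstoInDistribution_of_map_eq
    (tendstoInDistribution_momentMap_proj_coeff (γ := γ) (P := ν) (X := fun _ x => x)
      (fun n i => (measurePreserving_eval
        (fun i : Fin (2 * n - 1) => coeffLaw γ (scaledRate n) n i) i).hasLaw)
      (fun n => iIndepFun_pi fun i => aemeasurable_id) k)
    (fun n => (hnorm n).comp_aemeasurable ?_) (by fun_prop) ?_ rfl
  · obtain rfl | hn := n.eq_zero_or_pos
    · have : Subsingleton (Fin (2 * 0 - 1) → ℝ) := inferInstanceAs (Subsingleton (Fin 0 → ℝ))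
      exact (measurable_of_subsingleton_codomain _).aemeasurable
    · exact (hM n hn).aemeasurable
  · filter_upwards [eventually_gt_atTop k] with n hn
    have hlaw := hM n (by lia)
    have : IsProbabilityMeasure (momentLaw γ (scaledRate n) n) :=
      hlaw.isProbabilityMeasure_iff.1 inferInstance
    simp only [← proj_momentMap (show k ≤ 2 * n - 1 by lia), ← semicircleMoments_eq_momentMap]
    have hmap : (ν n).map (momentMap (2 * n - 1)) = (P n).map (M n) := by
      rw [hlaw.map_eq,
        ← map_momentMap_pi_coeffLaw hγ (fun j _ => scaledRate_pos (by lia) j) (by lia)]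
    have hcomp := congrArg (Measure.map fun m => √(2 * n) • (proj k m - semicircleMoments k)) hmap
    rwa [Measure.map_map (hnorm n) (continuous_momentMap _).measurable,
      AEMeasurable.map_map_of_aemeasurable (hnorm n).aemeasurable hlaw.aemeasurable] at hcomp

end Fluctuations

end RandomMoments

end

open RandomMoments in
theorem mainTheorem2
    (γ : ℕ → ℝ) (hγ : ∀ k, 1 ≤ k → -1 < γ k)
    {Ω : ℕ → Type*} [∀ n, MeasurableSpace (Ω n)]
    (P : (n : ℕ) → Measure (Ω n)) [∀ n, IsProbabilityMeasure (P n)]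
    (M : (n : ℕ) → Ω n → (Fin (2 * n - 1) → ℝ))
    (hM : ∀ n, 1 ≤ n → HasLaw (M n)
      (RandomMoments.momentLaw γ (fun j => if Odd j then (n : ℝ) else 2 * n) n) (P n))
    (k : ℕ) :
    (∀ i : Fin k, RandomMoments.semicircleMoments k i =
      if Even ((i : ℕ) + 1) then
        1 / ((((i : ℕ) + 1) / 2 : ℕ) + 1 : ℝ) *
          ((2 * (((i : ℕ) + 1) / 2)).choose (((i : ℕ) + 1) / 2) : ℝ)
      else 0) ∧
    IsUnit (RandomMoments.matD k).det ∧
    TendstoInDistribution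
      (fun (n : ℕ) (ω : Ω n) => WithLp.toLp 2
        (√(2 * n : ℝ) • ((RandomMoments.matD k)⁻¹ *ᵥ
          (RandomMoments.proj k (M n ω) - RandomMoments.semicircleMoments k))))
      atTop (id : EuclideanSpace ℝ (Fin k) → EuclideanSpace ℝ (Fin k)) P
      (multivariateGaussian 0 1) := by
  have hdet : IsUnit (matD k).det := by simp only [det_matD, isUnit_one]
  refine ⟨semicircleMoments_apply, hdet, ?_⟩
  have hinv : Continuous fun v : Fin k → ℝ =>
      (WithLp.toLp 2 ((matD k)⁻¹ *ᵥ v) : EuclideanSpace ℝ (Fin k)) :=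
    (PiLp.continuous_toLp 2 _).comp (continuous_const.matrix_mulVec continuous_id)
  have hlim := (tendstoInDistribution_proj_sub_semicircleMoments hγ hM k).continuous_comp hinv
  simp only [Function.comp_def, Matrix.mulVec_mulVec, Matrix.nonsing_inv_mul _ hdet,
    Matrix.one_mulVec, Matrix.mulVec_smul] at hlim
  refine tendstoInDistribution_of_map_eq hlim hlim.forall_aemeasurable aemeasurable_id
    (Eventually.of_forall fun n => rfl) ?_
  rw [Measure.map_id, multivariateGaussian_zero_one, map_pi_eq_stdGaussian]
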